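/- **Setting.** For $p\ge 1$ let $\mathbb T_{n,p}$ be the set of rooted type I triangulations of the $p$-gon with $n$ inner vertices (rooted planar maps, loops and multiple edges allowed, whose face to the right of the root edge is simple of degree $p$ and whose other faces are triangles; for $p=2$ the single edge is included, with $n=0$). The critical Boltzmann distribution on $\bigcup_n\mathbb T_{n,p}$ gives mass $(12\sqrt3)^{-n}/Z(p)$ to each element of $\mathbb T_{n,p}$, where $Z(p)=\sum_n(12\sqrt3)^{-n}\#\mathbb T_{n,p}$. Let $\theta$ be the probability distribution on $\{0,1,2,\dots\}$ with generating function $\sum_i\theta(i)x^i=1-\bigl(1+\frac1{\sqrt{1-x}}\bigr)^{-2}$, $0\le x<1$. The lower half-plane triangulation (LHPT) $\mathcal L$ is the following random infinite planar map. Let $(\mathscr T_i)_{i\in\mathbb Z}$ be independent Galton–Watson trees with offspring distribution $\theta$, embedded in order in the lower half-plane so that the root of $\mathscr T_i$ is $(\frac12+i,0)$, the vertices at height $k$ are the points of $(\frac12+\mathbb Z)\times\{-k\}$, and the vertices of the trees $\mathscr T_i$, $i\ge0$, are the points $(\frac12+i,-k)$ with $i,k\geq 0$. For all $i\in\mathbb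 Z$ and $k\ge0$, the horizontal segment from $(i,-k)$ to $(i+1,-k)$ is an edge, and it is a side of a downward triangle whose third vertex is $(s,-k-1)$, where $s$ is the minimal integer such that $(\frac12+s,-k-1)$ is a child of $(\frac12+i',-k)$ for some $i'>i$. The complement of the downward triangles consists of slots, one below each point $(i,-k)$, the boundary of this slot having length $c+2$ if $(\frac12+i,-k)$ has $c$ children. Given the trees, the slots are filled in with independent critical Boltzmann triangulations of the $(c+2)$-gon; when $c=0$ and the filling is the single edge, the two sides of the slot are glued together. The root vertex is $\rho=(0,0)$, and $\mathcal L_r=\{(i,-r):i\in\mathbb Z\}$ is the horizontal line at depth $r$. Let $\kappa\in(0,1]$ and let $\mu$ be a probability measure supported on $[\kappa,1]$. Conditionally on $\mathcal L$, assign i.i.d. weights $w(e)$ of law $\mu$ to the edges of $\mathcal L$; let $\mathrm d_{\rm fpp}(x,y)=\inf_\gamma\sum_{e\in\gamma}w(e)$, the infimum being over all paths $\gamma$ from $x$ to $y$ in $\mathcal L$, and $\mathrm d_{\rm fpp}(\rho,\mathcal L_r)=\inf_{x\in\mathcal L_r}\mathrm d_{\rm fpp}(\rho,x)$. **Proposition.**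 There exists a deterministic constant $\mathbf c_0\in[\kappa,1]$, depending only on $\kappa$ and $\mu$, such that, almost surely, $$r^{-1}\,\mathrm d_{\rm fpp}(\rho,\mathcal L_r)\longrightarrow\mathbf c_0\qquad\text{as } r\to\infty,\ r\in\mathbb N .$$ -/

import Mathlib

open MeasureTheory ProbabilityTheory Filter
open scoped ENNReal Topology

noncomputable section

namespace LHPT

/-! ### Triangulations with a simple boundary -/

/-- A rooted type I triangulation of the `p`-gon, as a combinatorial map on the darts
(half-edges) `0, …, m - 1`. Every dart is an oriented edge: `flip` reverses it, and `next d` is the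
oriented edge that follows `d` along the face lying to the right of `d`. Hence edges, faces and
vertices are the cycles of `flip`, of `next` and of `next ∘ flip` (which permutes the darts that
have the same initial vertex). Loops and multiple edges are allowed. The face to the right of the
root dart is the boundary face. For `p = 2` the map made of a single edge is included. -/
structure PolygonTriangulation (p : ℕ) where
  /-- the number of darts -/
  m : ℕ
  flip : Equiv.Perm (Fin m)
  next : Equiv.Perm (Fin m)
  root : Fin m
  flip_flip : ∀ d, flip (flip d) = d
  flip_ne : ∀ d, flip d ≠ d
  connected : ∀ d, ∃ g ∈ Subgroup.closure {flip, next}, g root = d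
  /-- Euler's formula: the surface is the sphere -/
  planar : Nat.card (Quotient (Equiv.Perm.SameCycle.setoid (next * flip)))
      + Nat.card (Quotient (Equiv.Perm.SameCycle.setoid next))
      = Nat.card (Quotient (Equiv.Perm.SameCycle.setoid flip)) + 2
  /-- the boundary face has degree `p` -/
  boundary_degree : Function.minimalPeriod next root = p
  /-- the boundary face is simple: it visits every vertex at most once -/
  boundary_simple : ∀ d e, next.SameCycle root d → next.SameCycle root e →
    (next * flip).SameCycle d e → d = e
  /-- all the other faces are triangles -/
  triangle : ∀ d, ¬ next.SameCycle root d → Function.minimalPeriod next d = 3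

namespace PolygonTriangulation

variable {p : ℕ} (T : PolygonTriangulation p)

/-- The vertices of a triangulation. -/
def Vertex : Type := Quotient (Equiv.Perm.SameCycle.setoid (T.next * T.flip))

/-- The (unoriented) edges of a triangulation. -/
def Edge : Type := Quotient (Equiv.Perm.SameCycle.setoid T.flip)

/-- The initial vertex of a dart. -/
def origin (d : Fin T.m) : T.Vertex := Quotient.mk _ d

/-- The edge carrying a dart. -/
def edge (d : Fin T.m) : T.Edge := Quotient.mk _ d

/-- The `t`-th vertex of the boundary, listed from the initial vertex of the root edge and
following the root edge. -/
def boundaryVertex (t : ℕ) : T.Vertex := T.origin ((T.next ^ t) T.root)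

/-- A vertex is inner if it is not on the boundary. -/
def IsInner (v : T.Vertex) : Prop := ∀ t, v ≠ T.boundaryVertex t

/-- The number of inner vertices. -/
def innerCount : ℕ := Nat.card {v : T.Vertex // T.IsInner v}

/-- An injective labelling of the edges of a triangulation by natural numbers (the number of one
of the two darts of the edge). -/
def edgeLabel (e : T.Edge) : ℕ := (Quotient.out e : Fin T.m)

theorem edgeLabel_injective : Function.Injective T.edgeLabel := by
  intro e f h
  have h1 : (Quotient.out e : Fin T.m) = Quotient.out f := Fin.ext h
  rw [← Quotient.out_eq e, ← Quotient.out_eq f, h1]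

/-- Isomorphism of rooted maps. -/
instance isoSetoid (p : ℕ) : Setoid (PolygonTriangulation p) where
  r T U := ∃ φ : Fin T.m ≃ Fin U.m, (∀ d, φ (T.flip d) = U.flip (φ d)) ∧
    (∀ d, φ (T.next d) = U.next (φ d)) ∧ φ T.root = U.root
  iseqv :=
    { refl := fun T => ⟨Equiv.refl _, fun _ => rfl, fun _ => rfl, rfl⟩
      symm := by
        rintro T U ⟨φ, h1, h2, h3⟩
        refine ⟨φ.symm, fun d => ?_, fun d => ?_, ?_⟩
        · rw [Equiv.symm_apply_eq, h1, Equiv.apply_symm_apply]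
        · rw [Equiv.symm_apply_eq, h2, Equiv.apply_symm_apply]
        · rw [Equiv.symm_apply_eq, h3]
      trans := by
        rintro T U V ⟨φ, h1, h2, h3⟩ ⟨ψ, k1, k2, k3⟩
        exact ⟨φ.trans ψ, fun d => by simp [h1, k1], fun d => by simp [h2, k2],
          by simp [h3, k3]⟩ }

end PolygonTriangulation

/-- The set of all rooted type I triangulations of the `p`-gon, i.e. rooted combinatorial maps up
to isomorphism. -/
def Triang (p : ℕ) : Type := Quotient (PolygonTriangulation.isoSetoid p)

/-- A representative of a triangulation of the `p`-gon. -/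
def Triang.rep {p : ℕ} (t : Triang p) : PolygonTriangulation p := Quotient.out t

/-- The number of inner vertices of a triangulation. -/
def Triang.inner {p : ℕ} (t : Triang p) : ℕ := t.rep.innerCount

/-! ### The critical Boltzmann distribution -/

/-- The critical Boltzmann weight `(12 √3) ^ (-n)` of a triangulation with `n` inner vertices. -/
def boltzmannWeight {p : ℕ} (t : Triang p) : ℝ≥0∞ :=
  (ENNReal.ofReal (12 * Real.sqrt 3))⁻¹ ^ t.inner

/-- The partition function `Z(p) = ∑ₙ (12 √3) ^ (-n) #𝕋(n, p)`. -/
def partitionFunction (p : ℕ) : ℝ≥0∞ := ∑' t : Triang p, boltzmannWeight t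

/-- The mass given to `t` by the critical Boltzmann distribution on triangulations of the
`p`-gon. -/
def boltzmannMass {p : ℕ} (t : Triang p) : ℝ≥0∞ := boltzmannWeight t / partitionFunction p

/-! ### The offspring distribution `θ` -/

/-- The numbers `θ(k)`; see `hasSum_theta` for their generating function. -/
def thetaCoeff : ℕ → ℝ
  | 0 => 3 / 4
  | n + 1 => thetaCoeff n * ((2 * n + 1) / (2 * n + 6))

theorem thetaCoeff_pos (n : ℕ) : 0 < thetaCoeff n := by
  induction n with
  | zero => norm_num [thetaCoeff]
  | succ n ih => rw [thetaCoeff]; positivity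

theorem thetaCoeff_le (n : ℕ) : thetaCoeff n ≤ 3 / 2 / ((n + 1) * (n + 2)) := by
  induction n with
  | zero => norm_num [thetaCoeff]
  | succ n ih =>
    rw [thetaCoeff]
    have h1 : ((2 * n + 1) / (2 * n + 6) : ℝ) ≤ (n + 1) / (n + 3) := by
      rw [div_le_div_iff₀ (by positivity) (by positivity)]
      nlinarith [(Nat.cast_nonneg n : (0 : ℝ) ≤ n)]
    calc thetaCoeff n * ((2 * n + 1) / (2 * n + 6))
        ≤ 3 / 2 / ((n + 1) * (n + 2)) * ((n + 1) / (n + 3)) :=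
          mul_le_mul ih h1 (by positivity) (by positivity)
      _ = 3 / 2 / (((n + 1 : ℕ) + 1) * ((n + 1 : ℕ) + 2)) := by
          push_cast; field_simp; ring

theorem sum_thetaCoeff (n : ℕ) :
    ∑ k ∈ Finset.range n, thetaCoeff k = 1 - (2 * n + 4) / 3 * thetaCoeff n := by
  induction n with
  | zero => norm_num [thetaCoeff]
  | succ n ih =>
    rw [Finset.sum_range_succ, ih, thetaCoeff]
    push_cast
    field_simp
    ring

theorem hasSum_thetaCoeff_one : HasSum thetaCoeff 1 := by
  rw [hasSum_iff_tendsto_nat_of_nonneg fun n => (thetaCoeff_pos n).le]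
  simp only [sum_thetaCoeff]
  have h : Tendsto (fun n : ℕ => (2 * n + 4) / 3 * thetaCoeff n) atTop (𝓝 0) := by
    refine squeeze_zero (fun n => mul_nonneg (by positivity) (thetaCoeff_pos n).le)
      (g := fun n : ℕ => 1 / ((n : ℝ) + 1)) (fun n => ?_) tendsto_one_div_add_atTop_nhds_zero_nat
    calc (2 * n + 4) / 3 * thetaCoeff n
        ≤ (2 * n + 4) / 3 * (3 / 2 / ((n + 1) * (n + 2))) :=
          mul_le_mul_of_nonneg_left (thetaCoeff_le n) (by positivity)
      _ = 1 / ((n : ℝ) + 1) := by field_simp; ring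
  simpa using h.const_sub 1

/-- The offspring distribution `θ`. -/
def theta : PMF ℕ :=
  ⟨fun k => ENNReal.ofReal (thetaCoeff k), by
    have h := ENNReal.ofReal_tsum_of_nonneg (fun n => (thetaCoeff_pos n).le)
      hasSum_thetaCoeff_one.summable
    rw [hasSum_thetaCoeff_one.tsum_eq, ENNReal.ofReal_one] at h
    rw [h]
    exact ENNReal.summable.hasSum⟩

theorem thetaCoeff_eq_choose (n : ℕ) :
    thetaCoeff n = 2 * (-1) ^ n * Ring.choose (3 / 2 : ℝ) (n + 2) := by
  have key : ∀ k : ℕ, ((k : ℝ) + 1) * Ring.choose (3 / 2 : ℝ) (k + 1)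
      = Ring.choose (3 / 2 : ℝ) k * (3 / 2 - k) := by
    intro k
    have h1 := Ring.descPochhammer_eq_factorial_smul_choose (3 / 2 : ℝ) (k + 1)
    have h0 := Ring.descPochhammer_eq_factorial_smul_choose (3 / 2 : ℝ) k
    rw [descPochhammer_succ_right, Polynomial.smeval_mul, h0, Nat.factorial_succ] at h1
    simp [Polynomial.smeval_natCast] at h1
    have hk : (k.factorial : ℝ) ≠ 0 := by exact_mod_cast k.factorial_ne_zero
    apply mul_left_cancel₀ hk
    linarith
  induction n with
  | zero =>
    have h1 := key 0
    have h2 := key 1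
    simp at h1
    norm_num [h1] at h2
    norm_num [thetaCoeff]
    linarith
  | succ n ih =>
    have h := key (n + 2)
    rw [thetaCoeff, ih]
    push_cast at h
    have h' : Ring.choose (3 / 2 : ℝ) (n + 1 + 2)
        = Ring.choose (3 / 2 : ℝ) (n + 2) * (3 / 2 - (n + 2)) / (n + 3) := by
      rw [eq_div_iff (by positivity), ← h, show n + 1 + 2 = n + 2 + 1 by ring]
      ring
    rw [h', pow_succ]
    field_simp
    ring

/-- The generating function of `θ` is `x ↦ 1 - (1 + 1 / √(1 - x)) ^ (-2)`. -/
theorem hasSum_theta (x : ℝ) (hx : x ∈ Set.Ico (0 : ℝ) 1) :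
    HasSum (fun k => (theta k).toReal * x ^ k)
      (1 - ((1 + 1 / Real.sqrt (1 - x)) ^ 2)⁻¹) := by
  have ht : ∀ k, (theta k).toReal = thetaCoeff k := fun k =>
    ENNReal.toReal_ofReal (thetaCoeff_pos k).le
  simp only [ht]
  obtain ⟨hx0, hx1⟩ := hx
  rcases hx0.eq_or_lt with rfl | hx0
  · have := hasSum_ite_eq (0 : ℕ) (3 / 4 : ℝ)
    convert this using 1
    · ext k
      rcases k with _ | k <;> simp [thetaCoeff]
    · norm_num
  have hb : HasSum (fun n => Ring.choose (3 / 2 : ℝ) n * (-x) ^ n) ((1 - x) ^ (3 / 2 : ℝ)) := by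
    have h := (Real.one_add_rpow_hasFPowerSeriesOnBall_zero (a := 3 / 2)).hasSum (y := -x) (by
      rw [← ENNReal.ofReal_one, Metric.eball_ofReal]
      simp [abs_of_pos hx0, hx1])
    simpa [sub_eq_add_neg, -FormalMultilinearSeries.apply_eq_prod_smul_coeff] using h
  have hb2 := (hasSum_nat_add_iff' 2).mpr hb
  have hs : HasSum (fun k => thetaCoeff k * x ^ k)
      (2 / x ^ 2 * ((1 - x) ^ (3 / 2 : ℝ) - 1 + 3 / 2 * x)) := by
    have h := hb2.mul_left (2 / x ^ 2)
    have hv : 2 / x ^ 2 * ((1 - x) ^ (3 / 2 : ℝ)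
        - ∑ i ∈ Finset.range 2, Ring.choose (3 / 2 : ℝ) i * (-x) ^ i)
        = 2 / x ^ 2 * ((1 - x) ^ (3 / 2 : ℝ) - 1 + 3 / 2 * x) := by
      simp only [Finset.sum_range_succ, Finset.sum_range_zero, Ring.choose_zero_right,
        Ring.choose_one_right]
      ring
    rw [hv] at h
    refine h.congr_fun fun k => ?_
    rw [thetaCoeff_eq_choose, neg_pow x]
    field_simp
    ring
  convert hs using 1
  set s := Real.sqrt (1 - x) with hs_def
  have hs0 : 0 < s := Real.sqrt_pos.mpr (by linarith)
  have hs2 : x = 1 - s ^ 2 := by rw [hs_def, Real.sq_sqrt (by linarith)]; ring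
  have h32 : (1 - x) ^ (3 / 2 : ℝ) = s ^ 3 := by
    rw [hs_def, Real.sqrt_eq_rpow, ← Real.rpow_natCast, ← Real.rpow_mul (by linarith)]
    norm_num
  have hs1 : 1 - s ^ 2 ≠ 0 := by rw [← hs2]; exact hx0.ne'
  rw [h32, hs2]
  field_simp
  ring

/-! ### The deterministic construction of the lower half-plane triangulation -/

/-- The content of a slot: the number `c` of children of the corresponding tree vertex, and the
triangulation of the `(c + 2)`-gon that fills in the slot. -/
abbrev Slot : Type := Σ c : ℕ, Triang (c + 2)

instance : MeasurableSpace Slot := ⊤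

/-- The tree vertex `(1/2 + i, -k)` (individual number `i` of generation `k`) has a number of
children and its slot is filled in by a triangulation: these data are `env i k`. -/
abbrev Env : Type := ℤ → ℕ → Slot

namespace Env

variable (env : Env)

/-- The number of children of the tree vertex `(1/2 + i, -k)`. -/
def offspring (i : ℤ) (k : ℕ) : ℕ := (env i k).1

/-- The triangulation that fills in the slot below the vertex `(i, -k)`. -/
def filling (i : ℤ) (k : ℕ) : PolygonTriangulation (env.offspring i k + 2) := (env i k).2.rep

/-- The planar embedding of the forest: the children of `(1/2 + i, -k)` are, from left to right,
the tree vertices `(1/2 + l, -(k + 1))` with `childStart i k ≤ l < childStart (i + 1) k`. The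
individuals `i ≥ 0` have their children at the positions `0, 1, 2, …` and the individuals `i < 0`
have theirs at the positions `-1, -2, …`. -/
def childStart (i : ℤ) (k : ℕ) : ℤ :=
  ∑ l ∈ Finset.Ico 0 i, (env.offspring l k : ℤ) - ∑ l ∈ Finset.Ico i 0, (env.offspring l k : ℤ)

/-- The tree vertex `(1/2 + l, -(k + 1))` is a child of `(1/2 + i, -k)`. -/
def IsChild (l i : ℤ) (k : ℕ) : Prop := env.childStart i k ≤ l ∧ l < env.childStart (i + 1) k

theorem childStart_succ (i : ℤ) (k : ℕ) :
    env.childStart (i + 1) k = env.childStart i k + env.offspring i k := by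
  unfold childStart
  rcases le_or_gt 0 i with h | h
  · rw [Finset.Ico_eq_empty_of_le h, Finset.Ico_eq_empty_of_le (show (0 : ℤ) ≤ i + 1 by omega),
      ← Finset.insert_Ico_right_eq_Ico_add_one h, Finset.sum_insert (by simp)]
    simp [add_comm]
  · rw [Finset.Ico_eq_empty_of_le h.le, Finset.Ico_eq_empty_of_le (show i + 1 ≤ (0 : ℤ) by omega),
      ← Finset.insert_Ico_add_one_left_eq_Ico h, Finset.sum_insert (by simp)]
    simp

theorem childStart_mono (k : ℕ) : Monotone fun i => env.childStart i k :=
  monotone_int_of_le_succ fun i => by simp [childStart_succ]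

/-- The third vertex of the downward triangle containing `[i, i + 1] × {-k}` is `(s, -(k + 1))`,
where `s` is the minimal integer such that `(1/2 + s, -(k + 1))` is a child of `(1/2 + i', -k)` for
some `i' > i`. This integer is `childStart (i + 1) k`. -/
theorem isLeast_childStart (i : ℤ) (k : ℕ) (h : ∃ l i', i < i' ∧ env.IsChild l i' k) :
    IsLeast {l | ∃ i', i < i' ∧ env.IsChild l i' k} (env.childStart (i + 1) k) := by
  have hlow : ∀ l i', i < i' → env.IsChild l i' k → env.childStart (i + 1) k ≤ l :=
    fun l i' hi hl => (env.childStart_mono k (show i + 1 ≤ i' by omega)).trans hl.1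
  refine ⟨?_, fun l ⟨i', hi, hl⟩ => hlow l i' hi hl⟩
  obtain ⟨l, i', hi, hl⟩ := h
  have hlt : env.childStart (i + 1) k < env.childStart (i' + 1) k :=
    (hlow l i' hi hl).trans_lt hl.2
  have hex : ∃ n : ℕ, env.childStart (i + 1) k < env.childStart (i + 1 + n + 1) k := by
    refine ⟨(i' - (i + 1)).toNat, ?_⟩
    rwa [show i + 1 + ((i' - (i + 1)).toNat : ℤ) + 1 = i' + 1 by omega]
  classical
  refine ⟨i + 1 + (Nat.find hex : ℕ), by omega, ?_, Nat.find_spec hex⟩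
  rcases hn : Nat.find hex with _ | n
  · simp
  · have := Nat.find_min hex (m := n) (by omega)
    push_cast
    rw [← add_assoc]
    exact not_lt.mp this

/-- The vertices of the lower half-plane triangulation: the points `(i, -k)`, and the inner
vertices of the triangulations that fill in the slots. -/
inductive Vertex (env : Env) : Type
  | grid (i : ℤ) (k : ℕ) : Vertex env
  | inner (i : ℤ) (k : ℕ) (v : (env.filling i k).Vertex) (hv : (env.filling i k).IsInner v) :
      Vertex env

/-- The edges of the lower half-plane triangulation: the horizontal edges `[i, i + 1] × {0}` of the
boundary, and the edges of the triangulations that fill in the slots. (Two different slots have no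
common edge, and every edge of a downward triangle other than a boundary edge belongs to the
boundary of a slot.) -/
inductive Edge (env : Env) : Type
  | top (i : ℤ) : Edge env
  | slot (i : ℤ) (k : ℕ) (e : (env.filling i k).Edge) : Edge env

/-- The boundary of the slot below `(i, -k)`, listed counterclockwise. The third vertex of the
downward triangle containing the horizontal edge `[i, i + 1] × {-k}` is `(s, -(k + 1))` with
`s = childStart (i + 1) k`, so this boundary starts at the vertex
`(childStart (i + 1) k, -(k + 1))`, goes up to `(i, -k)` along the root edge, then down to
`(childStart i k, -(k + 1))`, and then runs to the right along the horizontal edges that carry the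
children of `(1/2 + i, -k)`. -/
def corner (i : ℤ) (k : ℕ) : ℕ → Vertex env
  | 0 => .grid (env.childStart (i + 1) k) (k + 1)
  | 1 => .grid i k
  | t + 2 => .grid (env.childStart i k + t) (k + 1)

open Classical in
/-- The gluing of the filling of a slot along the boundary of the slot. -/
def glue (i : ℤ) (k : ℕ) (v : (env.filling i k).Vertex) : Vertex env :=
  if h : ∃ t, v = (env.filling i k).boundaryVertex t then env.corner i k (Nat.find h)
  else .inner i k v (not_exists.mp h)

/-- `Joins e u v`: the edge `e` can be traversed from `u` to `v`. -/
inductive Joins : Edge env → Vertex env → Vertex env → Prop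
  | top_right (i : ℤ) : Joins (.top i) (.grid i 0) (.grid (i + 1) 0)
  | top_left (i : ℤ) : Joins (.top i) (.grid (i + 1) 0) (.grid i 0)
  | slot (i : ℤ) (k : ℕ) (d : Fin (env.filling i k).m) :
      Joins (.slot i k ((env.filling i k).edge d))
        (env.glue i k ((env.filling i k).origin d))
        (env.glue i k ((env.filling i k).origin ((env.filling i k).flip d)))

/-- `IsPath u γ v`: the list of edges `γ` is a path from `u` to `v`. -/
inductive IsPath : Vertex env → List (Edge env) → Vertex env → Prop
  | nil (u : Vertex env) : IsPath u [] u
  | cons {e : Edge env} {u v w : Vertex env} {γ : List (Edge env)} (h : env.Joins e u v)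
      (h' : IsPath v γ w) : IsPath u (e :: γ) w

/-- The first-passage percolation distance between two vertices, for the edge weights `w`. -/
def dfpp (w : Edge env → ℝ) (u v : Vertex env) : ℝ≥0∞ :=
  ⨅ (γ : List (Edge env)) (_ : env.IsPath u γ v), (γ.map fun e => ENNReal.ofReal (w e)).sum

/-- The first-passage percolation distance between the root vertex `(0, 0)` and the horizontal line
`{(i, -r) : i ∈ ℤ}`. -/
def dfppLine (w : Edge env → ℝ) (r : ℕ) : ℝ≥0∞ :=
  ⨅ i : ℤ, env.dfpp w (.grid 0 0) (.grid i r)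

/-- Universal labels for the edges: boundary edges are labelled by `ℤ`, and the edges of the filling
of the slot below `(i, -k)` by triples `(i, k, n)`. -/
abbrev EdgeLabel : Type := ℤ ⊕ (ℤ × ℕ × ℕ)

/-- The label of an edge. -/
def label : Edge env → EdgeLabel
  | .top i => .inl i
  | .slot i k e => .inr (i, k, (env.filling i k).edgeLabel e)

theorem label_injective : Function.Injective env.label := by
  rintro (i | ⟨i, k, e⟩) (j | ⟨j, l, f⟩) h
  · simpa [label] using h
  · simp [label] at h
  · simp [label] at h
  · simp only [label, Sum.inr.injEq, Prod.mk.injEq] at h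
    obtain ⟨rfl, rfl, h⟩ := h
    rw [(env.filling i k).edgeLabel_injective h]

end Env

/-! ### The random lower half-plane triangulation with i.i.d. edge weights -/

/-- The law of the content of a slot: the number of children has law `θ`, and given that it equals
`c`, the filling is a Boltzmann triangulation of the `(c + 2)`-gon. -/
def slotLaw : Measure Slot :=
  Measure.sum fun s : Slot => (theta s.1 * boltzmannMass s.2) • Measure.dirac s

/-- `slot` and `W` are the data of a lower half-plane triangulation with i.i.d. edge weights of law
`μ`. The numbers of children of the individuals are i.i.d. with law `θ`, so that the
trees rooted at the tree vertices `(1/2 + i, 0)` are independent Galton–Watson trees with offspring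
distribution `θ`; given the trees, the fillings of the slots are independent Boltzmann
triangulations; and given the triangulation, the weights of its edges are i.i.d. with
law `μ`. -/
structure IsWeightedLHPT {Ω : Type*} [MeasurableSpace Ω] (P : Measure Ω)
    (slot : ℤ × ℕ → Ω → Slot) (W : Env.EdgeLabel → Ω → ℝ) (μ : Measure ℝ) : Prop where
  measurable_slot : ∀ x, Measurable (slot x)
  map_slot : ∀ x, P.map (slot x) = slotLaw
  indep_slot : iIndepFun slot P
  measurable_weight : ∀ l, Measurable (W l)
  map_weight : ∀ l, P.map (W l) = μ
  indep_weight : iIndepFun W P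
  indep : IndepFun (fun ω x => slot x ω) (fun ω l => W l ω) P

/-- The data of the triangulation at the sample point `ω`. -/
def envAt {Ω : Type*} (slot : ℤ × ℕ → Ω → Slot) (ω : Ω) : Env := fun i k => slot (i, k) ω

/-- `d_fpp(ρ, L_r)` at the sample point `ω`: the first-passage percolation distance from the root
vertex to the horizontal line at depth `r`. -/
def rootToLine {Ω : Type*} (slot : ℤ × ℕ → Ω → Slot) (W : Env.EdgeLabel → Ω → ℝ) (ω : Ω) (r : ℕ) :
    ℝ≥0∞ :=
  (envAt slot ω).dfppLine (fun e => W ((envAt slot ω).label e) ω) r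

end LHPT

end

/-! A path from the root to the line at depth `r` can be stopped when it first meets this line, so
only what lies above the line matters. Cut the triangulation into rows: a row consists of one
generation of slots together with the weights of its edges, where horizontal edges are assigned to
the row below them. The rows are then i.i.d., and the law of a row is invariant under horizontal
translations. The distance to the line at depth `r` becomes `crossing`, a functional of the first
`r` rows, which lies between `κ * r` and `r`.

Explore the first `m` rows and choose, as a function of them alone, a vertex at depth `m` whose
distance to the root is minimal up to `1`. Seen from that vertex, the lower rows have the original
law and are independent of the explored ones, because moving the origin translates each row by an
amount that depends only on the rows above it (`measurePreserving_reroot`,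
`measurePreserving_truncate_regenerate`). With `Θ m = regenerate hκ m` and `Y n = crossing + 1`,
concatenating paths gives `Y (m + n) ≤ Y m + Y n ∘ Θ m`.

The `Θ m` are not assumed to form a semigroup, and subadditivity is only available for intervals
starting at `0`, so `exists_tendsto_div_of_subadditive` is proved from scratch. Let `c = lim E[Y n]
/ n`. Blocks of a fixed length are pairwise independent, so the strong law of large numbers gives
`limsup Y n / n ≤ c`. Conversely, `L = liminf Y n / n` satisfies `L ≤ L ∘ Θ m`, hence equality
almost surely as `Θ m` preserves the measure. Chaining short intervals along which `Y` grows at a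
rate close to `L` gives `c ≤ E[L]`. Together these force `L = c` almost surely.

To return to the triangulation, two facts are used: almost surely every tree vertex of positive
generation has a parent (`ae_covered`), so that all horizontal edges of the rows are present; and,
given the trees and fillings, assigning edge weights to rows is an injective relabelling, so the
weights stay i.i.d. (`measurePreserving_weights`). -/

noncomputable section

namespace LHPT

/-! ### A subadditive ergodic theorem -/

section Subadditive

variable {Ω : Type*} {Y : ℕ → Ω → ℝ} {Θ : ℕ → Ω → Ω}

/-- If a process is subadditive along the shifts `Θ`, and every point of the orbit outside of a set
`B` has a short time interval along which the process grows at a rate at most `l`, then the process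
grows at a rate at most `l`, up to the number of visits to `B`. -/
theorem exists_le_of_short_excursions (h1 : ∀ n ω, Y n ω ≤ n + 1)
    (hsub : ∀ m n ω, Y (m + n) ω ≤ Y m ω + Y n (Θ m ω)) (ω : Ω) (l : ℝ) (hl : 0 ≤ l) (N : ℕ)
    (B : Set Ω) (hB : ∀ m, Θ m ω ∉ B → ∃ t, 1 ≤ t ∧ t ≤ N ∧ Y t (Θ m ω) ≤ t * l) (n : ℕ) :
    ∃ R, R ≤ n ∧ n ≤ R + N ∧
      Y R ω ≤ 1 + R * l + 2 * ∑ m ∈ Finset.range R, B.indicator (fun _ => (1 : ℝ)) (Θ m ω) := by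
  induction n with
  | zero => exact ⟨0, le_rfl, by omega, by simpa using h1 0 ω⟩
  | succ n ih =>
    obtain ⟨R, hR, hn, hY⟩ := ih
    by_cases hlt : n + 1 ≤ R + N
    · exact ⟨R, by omega, hlt, hY⟩
    -- Here `n = R + N`. From a bad point advance by one unit, at cost at most `Y 1 ≤ 2`, hence the
    -- factor `2`; from a good point jump by `t ≤ N`.
    by_cases hb : Θ R ω ∈ B
    · refine ⟨R + 1, by omega, by omega, ?_⟩
      have h2 := hsub R 1 ω
      have h3 := h1 1 (Θ R ω)
      rw [Finset.sum_range_succ, Set.indicator_of_mem hb]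
      push_cast at h3 ⊢
      nlinarith
    · obtain ⟨t, ht1, htN, ht⟩ := hB R hb
      refine ⟨R + t, by omega, by omega, ?_⟩
      have h2 := hsub R t ω
      have h3 : ∑ m ∈ Finset.range R, B.indicator (fun _ => (1 : ℝ)) (Θ m ω) ≤
          ∑ m ∈ Finset.range (R + t), B.indicator (fun _ => (1 : ℝ)) (Θ m ω) :=
        Finset.sum_le_sum_of_subset_of_nonneg (Finset.range_mono (by omega))
          fun _ _ _ => Set.indicator_nonneg (fun _ _ => zero_le_one) _
      push_cast
      nlinarith

/-- The last piece, from `R` to `n`, has length at most `N` and so costs at most `N + 1`; with the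
initial `1` this makes `N + 2`. -/
theorem le_of_short_excursions (h1 : ∀ n ω, Y n ω ≤ n + 1)
    (hsub : ∀ m n ω, Y (m + n) ω ≤ Y m ω + Y n (Θ m ω)) (ω : Ω) (l : ℝ) (hl : 0 ≤ l) (N : ℕ)
    (B : Set Ω) (hB : ∀ m, Θ m ω ∉ B → ∃ t, 1 ≤ t ∧ t ≤ N ∧ Y t (Θ m ω) ≤ t * l) (n : ℕ) :
    Y n ω ≤ n * l + 2 * ∑ m ∈ Finset.range n, B.indicator (fun _ => (1 : ℝ)) (Θ m ω) + (N + 2) := by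
  obtain ⟨R, hR, hn, hY⟩ := exists_le_of_short_excursions h1 hsub ω l hl N B hB n
  have h2 := hsub R (n - R) ω
  rw [Nat.add_sub_cancel' hR] at h2
  have h3 := h1 (n - R) (Θ R ω)
  have h4 : ((n - R : ℕ) : ℝ) ≤ N := by exact_mod_cast (by omega : n - R ≤ N)
  have h5 : ∑ m ∈ Finset.range R, B.indicator (fun _ => (1 : ℝ)) (Θ m ω) ≤
      ∑ m ∈ Finset.range n, B.indicator (fun _ => (1 : ℝ)) (Θ m ω) :=
    Finset.sum_le_sum_of_subset_of_nonneg (Finset.range_mono hR)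
      fun _ _ _ => Set.indicator_nonneg (fun _ _ => zero_le_one) _
  have h6 : (R : ℝ) * l ≤ n * l := mul_le_mul_of_nonneg_right (by exact_mod_cast hR) hl
  linarith

theorem div_mem_Icc (h0 : ∀ n ω, 0 ≤ Y n ω) (h1 : ∀ n ω, Y n ω ≤ n + 1) (n : ℕ) (ω : Ω) :
    Y n ω / n ∈ Set.Icc (0 : ℝ) 2 := by
  refine ⟨div_nonneg (h0 n ω) (Nat.cast_nonneg n), ?_⟩
  rcases Nat.eq_zero_or_pos n with rfl | hn
  · simp
  · have : (1 : ℝ) ≤ n := by exact_mod_cast hn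
    rw [div_le_iff₀ (by linarith)]
    linarith [h1 n ω]

theorem isBoundedUnder_ge_div (h0 : ∀ n ω, 0 ≤ Y n ω) (h1 : ∀ n ω, Y n ω ≤ n + 1) (ω : Ω) :
    IsBoundedUnder (· ≥ ·) atTop fun n : ℕ => Y n ω / n :=
  isBoundedUnder_of ⟨0, fun n => (div_mem_Icc h0 h1 n ω).1⟩

theorem isBoundedUnder_le_div (h0 : ∀ n ω, 0 ≤ Y n ω) (h1 : ∀ n ω, Y n ω ≤ n + 1) (ω : Ω) :
    IsBoundedUnder (· ≤ ·) atTop fun n : ℕ => Y n ω / n :=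
  isBoundedUnder_of ⟨2, fun n => (div_mem_Icc h0 h1 n ω).2⟩

/-- Constants are negligible with respect to a linear growth. -/
theorem eventually_const_add_mul_le {x b b' : ℝ} (hb : b' < b) :
    ∀ᶠ n : ℕ in atTop, x + b' * n ≤ b * n := by
  obtain ⟨n₀, hn₀⟩ := exists_nat_ge (x / (b - b'))
  filter_upwards [eventually_ge_atTop n₀] with n hn
  have h : x / (b - b') ≤ n := hn₀.trans (by exact_mod_cast hn)
  rw [div_le_iff₀ (by linarith)] at h
  linarith

/-- Divide the subadditivity inequality by `n`: the term `Y m ω` is negligible. Only this inequality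
is pointwise; equality will follow almost surely by comparing integrals. -/
theorem liminf_le_liminf_shift (h0 : ∀ n ω, 0 ≤ Y n ω) (h1 : ∀ n ω, Y n ω ≤ n + 1)
    (hsub : ∀ m n ω, Y (m + n) ω ≤ Y m ω + Y n (Θ m ω)) (m : ℕ) (ω : Ω) :
    liminf (fun n : ℕ => Y n ω / n) atTop ≤ liminf (fun n : ℕ => Y n (Θ m ω) / n) atTop := by
  refine le_of_forall_gt_imp_ge_of_dense fun b hb => ?_
  obtain ⟨b', hb', hbb⟩ := exists_between hb
  have hfreq : ∃ᶠ n : ℕ in atTop, Y n (Θ m ω) / n < b' :=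
    frequently_lt_of_liminf_lt (isBoundedUnder_le_div h0 h1 (Θ m ω)).isCoboundedUnder_ge hb'
  refine liminf_le_of_frequently_le ?_ (isBoundedUnder_ge_div h0 h1 ω)
  have h2 := (hfreq.and_eventually (eventually_const_add_mul_le (x := Y m ω) hbb)).and_eventually
    (eventually_ge_atTop 1)
  have hb0 : 0 ≤ b := by
    obtain ⟨n, hn⟩ := hfreq.exists
    linarith [(div_mem_Icc h0 h1 n (Θ m ω)).1]
  refine (tendsto_add_atTop_nat m).frequently (h2.mono ?_)
  rintro n ⟨⟨h3, h4⟩, h5⟩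
  have hn : (1 : ℝ) ≤ n := by exact_mod_cast h5
  rw [div_lt_iff₀ (by linarith)] at h3
  rw [add_comm n m, div_le_iff₀ (by push_cast; positivity)]
  push_cast
  nlinarith [hsub m n ω, (Nat.cast_nonneg m : (0 : ℝ) ≤ m)]

/-! ### Expectations and almost sure limits -/

variable [MeasurableSpace Ω] {P : Measure Ω}

theorem bddBelow_integral_div (h0 : ∀ n ω, 0 ≤ Y n ω) :
    BddBelow (Set.range fun n : ℕ => (∫ ω, Y n ω ∂P) / n) := by
  refine ⟨0, ?_⟩
  rintro _ ⟨n, rfl⟩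
  exact div_nonneg (integral_nonneg (h0 n)) (Nat.cast_nonneg n)

variable [IsProbabilityMeasure P]

theorem integrable_of_le (hY : ∀ n, Measurable (Y n)) (h0 : ∀ n ω, 0 ≤ Y n ω)
    (h1 : ∀ n ω, Y n ω ≤ n + 1) (n : ℕ) : Integrable (Y n) P :=
  Integrable.of_bound (hY n).aestronglyMeasurable (n + 1) (ae_of_all _ fun ω => by
    rw [Real.norm_of_nonneg (h0 n ω)]; exact h1 n ω)

theorem subadditive_integral (hY : ∀ n, Measurable (Y n)) (h0 : ∀ n ω, 0 ≤ Y n ω)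
    (h1 : ∀ n ω, Y n ω ≤ n + 1) (hΘ : ∀ m, MeasurePreserving (Θ m) P P)
    (hsub : ∀ m n ω, Y (m + n) ω ≤ Y m ω + Y n (Θ m ω)) :
    Subadditive fun n => ∫ ω, Y n ω ∂P := by
  intro m n
  have hi := integrable_of_le (P := P) hY h0 h1
  have h2 : ∫ ω, Y n (Θ m ω) ∂P = ∫ ω, Y n ω ∂P := by
    conv_rhs => rw [← (hΘ m).map_eq]
    rw [integral_map (hΘ m).measurable.aemeasurable (hY n).aestronglyMeasurable]
  change ∫ ω, Y (m + n) ω ∂P ≤ ∫ ω, Y m ω ∂P + ∫ ω, Y n ω ∂P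
  have hn : Integrable (fun ω => Y n (Θ m ω)) P := (hΘ m).integrable_comp_of_integrable (hi n)
  rw [← h2, ← integral_add (hi m) hn]
  exact integral_mono (hi _) ((hi m).add hn) (hsub m n)

/-- The upper bound in the subadditive ergodic theorem, for independent blocks. -/
theorem ae_eventually_div_le (hY : ∀ n, Measurable (Y n)) (h0 : ∀ n ω, 0 ≤ Y n ω)
    (h1 : ∀ n ω, Y n ω ≤ n + 1) (hΘ : ∀ m, MeasurePreserving (Θ m) P P)
    (hsub : ∀ m n ω, Y (m + n) ω ≤ Y m ω + Y n (Θ m ω))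
    (hind : ∀ k, Pairwise fun i j =>
      IndepFun (fun ω => Y k (Θ (i * k) ω)) (fun ω => Y k (Θ (j * k) ω)) P)
    (c : ℝ) (hc : Tendsto (fun n : ℕ => (∫ ω, Y n ω ∂P) / n) atTop (𝓝 c)) :
    ∀ᵐ ω ∂P, ∀ b > c, ∀ᶠ n : ℕ in atTop, Y n ω / n ≤ b := by
  have hi := integrable_of_le (P := P) hY h0 h1
  have hmap : ∀ k m, P.map (fun ω => Y k (Θ m ω)) = P.map (Y k) := fun k m => by
    change P.map (Y k ∘ Θ m) = _
    rw [← Measure.map_map (hY k) (hΘ m).measurable, (hΘ m).map_eq]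
  have hm : ∀ k m, Measurable fun ω => Y k (Θ m ω) := fun k m => (hY k).comp (hΘ m).measurable
  -- Pairwise independence of the blocks is enough for the strong law.
  have hslln : ∀ᵐ ω ∂P, ∀ k, Tendsto
      (fun j : ℕ => (∑ i ∈ Finset.range j, Y k (Θ (i * k) ω)) / j) atTop
      (𝓝 (∫ ω, Y k ω ∂P)) := by
    refine ae_all_iff.mpr fun k => ?_
    have h := strong_law_ae_real (μ := P) (fun i ω => Y k (Θ (i * k) ω))
      ((hΘ _).integrable_comp_of_integrable (hi k)) (hind k)
      fun i => ⟨(hm _ _).aemeasurable, (hm _ _).aemeasurable, by rw [hmap, hmap]⟩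
    have h2 : ∫ ω, Y k (Θ (0 * k) ω) ∂P = ∫ ω, Y k ω ∂P := by
      conv_rhs => rw [← (hΘ (0 * k)).map_eq]
      rw [integral_map (hΘ _).measurable.aemeasurable (hY k).aestronglyMeasurable]
    simpa only [h2] using h
  filter_upwards [hslln] with ω hω b hb
  obtain ⟨b', hb', hbb⟩ := exists_between hb
  obtain ⟨k, hk, hk1⟩ := ((hc.eventually (gt_mem_nhds hb')).and (eventually_ge_atTop 1)).exists
  have hk0 : (1 : ℝ) ≤ k := by exact_mod_cast hk1
  rw [div_lt_iff₀ (by linarith)] at hk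
  have hblock : ∀ j, Y (j * k) ω ≤ 1 + ∑ i ∈ Finset.range j, Y k (Θ (i * k) ω) := by
    intro j
    induction j with
    | zero => simpa using h1 0 ω
    | succ j ih =>
      rw [Finset.sum_range_succ, Nat.succ_mul]
      linarith [hsub (j * k) k ω]
  have hdiv : Tendsto (fun n : ℕ => n / k) atTop atTop := Nat.tendsto_div_const_atTop (by omega)
  -- The sign is needed to replace `n / k * k` by the larger `n` in the final estimate.
  have hb0 : 0 ≤ b' := by
    have : 0 ≤ ∫ ω, Y k ω ∂P := integral_nonneg (h0 k)
    by_contra hneg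
    nlinarith
  filter_upwards [hdiv.eventually ((hω k).eventually (gt_mem_nhds hk)),
    -- The constant `k + 2` is the `1` of `hblock` plus at most `k + 1` for the incomplete last
    -- block.
    hdiv.eventually (eventually_ge_atTop 1), eventually_const_add_mul_le (x := k + 2) hbb,
    eventually_ge_atTop 1] with n hn hn1 hn2 hn3
  have hq : (1 : ℝ) ≤ (n / k : ℕ) := by exact_mod_cast hn1
  rw [div_lt_iff₀ (by linarith)] at hn
  rw [div_le_iff₀ (by exact_mod_cast hn3)]
  have h2 := hsub (n / k * k) (n % k) ω
  rw [Nat.div_add_mod'] at h2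
  have h3 := h1 (n % k) (Θ (n / k * k) ω)
  have h4 : ((n % k : ℕ) : ℝ) ≤ k := by exact_mod_cast (Nat.mod_lt n hk1).le
  have h5 := hblock (n / k)
  have h6 : ((n / k : ℕ) : ℝ) * k ≤ n := by exact_mod_cast Nat.div_mul_le_self n k
  nlinarith

/-- **A subadditive ergodic theorem** (in the spirit of Liggett), for processes with bounded
increments and independent blocks. Subadditivity is only required for intervals that start
at `0`. -/
theorem exists_tendsto_div_of_subadditive (hY : ∀ n, Measurable (Y n)) (h0 : ∀ n ω, 0 ≤ Y n ω)
    (h1 : ∀ n ω, Y n ω ≤ n + 1) (hΘ : ∀ m, MeasurePreserving (Θ m) P P)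
    (hsub : ∀ m n ω, Y (m + n) ω ≤ Y m ω + Y n (Θ m ω))
    (hind : ∀ k, Pairwise fun i j =>
      IndepFun (fun ω => Y k (Θ (i * k) ω)) (fun ω => Y k (Θ (j * k) ω)) P) :
    ∃ c, ∀ᵐ ω ∂P, Tendsto (fun n : ℕ => Y n ω / n) atTop (𝓝 c) := by
  have hi := integrable_of_le (P := P) hY h0 h1
  have hS := subadditive_integral hY h0 h1 hΘ hsub
  set c := hS.lim
  have hc := hS.tendsto_lim (bddBelow_integral_div h0)
  refine ⟨c, ?_⟩
  have hup := ae_eventually_div_le hY h0 h1 hΘ hsub hind c hc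
  set L : Ω → ℝ := fun ω => liminf (fun n : ℕ => Y n ω / n) atTop with hL
  have hLm : Measurable L := Measurable.liminf fun n => (hY n).div_const _
  have hL0 : ∀ ω, 0 ≤ L ω := fun ω =>
    le_liminf_of_le (isBoundedUnder_le_div h0 h1 ω).isCoboundedUnder_ge
      (Eventually.of_forall fun n => (div_mem_Icc h0 h1 n ω).1)
  have hL2 : ∀ ω, L ω ≤ 2 := fun ω =>
    liminf_le_of_frequently_le (Frequently.of_forall fun n => (div_mem_Icc h0 h1 n ω).2)
      (isBoundedUnder_ge_div h0 h1 ω)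
  have hLi : Integrable L P :=
    Integrable.of_bound hLm.aestronglyMeasurable 2 (ae_of_all _ fun ω => by
      rw [Real.norm_of_nonneg (hL0 ω)]; exact hL2 ω)
  have hLΘ : ∀ᵐ ω ∂P, ∀ m, L ω = L (Θ m ω) := by
    refine ae_all_iff.mpr fun m => ?_
    have h2 : ∫ ω, L ω ∂P = ∫ ω, L (Θ m ω) ∂P := by
      conv_lhs => rw [← (hΘ m).map_eq]
      rw [integral_map (hΘ m).measurable.aemeasurable hLm.aestronglyMeasurable]
    -- A function that is below its composition with a measure-preserving map has the same integral,
    -- so the two agree almost surely.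
    exact (integral_eq_iff_of_ae_le hLi ((hΘ m).integrable_comp_of_integrable hLi)
      (ae_of_all _ fun ω => liminf_le_liminf_shift h0 h1 hsub m ω)).mp h2
  -- the lower bound in expectation
  have hlow : c ≤ ∫ ω, L ω ∂P := by
    refine le_of_forall_pos_le_add fun ε hε => ?_
    -- The bad points, from which no time `t ≤ N` achieves the rate `L + ε`. Since `L` is the
    -- liminf, these sets decrease to the empty set.
    let B : ℕ → Set Ω := fun N => {ω | ∀ t : ℕ, 1 ≤ t → t ≤ N → t * (L ω + ε) < Y t ω}
    have hBm : ∀ N, MeasurableSet (B N) := fun N => by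
      simp only [B, Set.ofPred_forall]
      exact MeasurableSet.iInter fun t => MeasurableSet.iInter fun _ => MeasurableSet.iInter fun _ =>
        measurableSet_lt ((hLm.add_const ε).const_mul _) (hY t)
    have hBanti : Antitone B := fun N N' hN ω hω t ht htN => hω t ht (htN.trans hN)
    have hBempty : ⋂ N, B N = ∅ := by
      refine Set.eq_empty_of_forall_notMem fun ω hω => ?_
      have hfreq : ∃ᶠ n : ℕ in atTop, Y n ω / n < L ω + ε :=
        frequently_lt_of_liminf_lt (isBoundedUnder_le_div h0 h1 ω).isCoboundedUnder_ge
          (lt_add_of_pos_right _ hε)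
      obtain ⟨n, hn, hn1⟩ := (hfreq.and_eventually (eventually_ge_atTop 1)).exists
      have hn0 : (0 : ℝ) < n := by exact_mod_cast hn1
      rw [div_lt_iff₀ hn0] at hn
      have := Set.mem_iInter.mp hω n n hn1 le_rfl
      linarith
    have hBlim : Tendsto (fun N => P.real (B N)) atTop (𝓝 0) := by
      have h := tendsto_measure_iInter_atTop (μ := P) (fun N => (hBm N).nullMeasurableSet) hBanti
        ⟨0, measure_ne_top _ _⟩
      rw [hBempty, measure_empty] at h
      exact (ENNReal.tendsto_toReal ENNReal.zero_ne_top).comp h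
    have hbound : ∀ N, c ≤ (∫ ω, L ω ∂P) + ε + 2 * P.real (B N) := by
      intro N
      have hn : ∀ n : ℕ, ∫ ω, Y n ω ∂P ≤
          n * ((∫ ω, L ω ∂P) + ε + 2 * P.real (B N)) + (N + 2) := by
        intro n
        have hae : ∀ᵐ ω ∂P, Y n ω ≤ n * (L ω + ε) +
            2 * ∑ m ∈ Finset.range n, (B N).indicator (fun _ => (1 : ℝ)) (Θ m ω) + (N + 2) := by
          filter_upwards [hLΘ] with ω hω
          refine le_of_short_excursions h1 hsub ω (L ω + ε) (by linarith [hL0 ω]) N (B N) ?_ n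
          intro m hm
          -- Membership of `Θ m ω` in `B N` involves `L (Θ m ω)`; by the almost sure invariance this
          -- is `L ω`, so a single rate serves for the whole orbit.
          simp only [B, Set.mem_ofPred_eq, not_forall, not_lt, ← hω m] at hm
          obtain ⟨t, ht1, htN, ht⟩ := hm
          exact ⟨t, ht1, htN, ht⟩
        have hind1 : ∀ m, Integrable (fun ω => (B N).indicator (fun _ => (1 : ℝ)) (Θ m ω)) P :=
          fun m => (hΘ m).integrable_comp_of_integrable
            ((integrable_const (1 : ℝ)).indicator (hBm N))
        have hind2 : ∀ m, ∫ ω, (B N).indicator (fun _ => (1 : ℝ)) (Θ m ω) ∂P = P.real (B N) := by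
          intro m
          rw [← integral_map (f := (B N).indicator fun _ => (1 : ℝ)) (hΘ m).measurable.aemeasurable
            (measurable_const.indicator (hBm N)).aestronglyMeasurable, (hΘ m).map_eq,
            integral_indicator_const _ (hBm N)]
          simp
        have hsum : Integrable
            (fun ω => ∑ m ∈ Finset.range n, (B N).indicator (fun _ => (1 : ℝ)) (Θ m ω)) P :=
          integrable_finsetSum _ fun m _ => hind1 m
        have hA : Integrable (fun ω => (n : ℝ) * (L ω + ε)) P :=
          (hLi.add (integrable_const ε)).const_mul _
        have hC : Integrable (fun ω =>
            2 * ∑ m ∈ Finset.range n, (B N).indicator (fun _ => (1 : ℝ)) (Θ m ω)) P :=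
          hsum.const_mul 2
        have hAC : Integrable (fun ω => (n : ℝ) * (L ω + ε) +
            2 * ∑ m ∈ Finset.range n, (B N).indicator (fun _ => (1 : ℝ)) (Θ m ω)) P := hA.add hC
        refine (integral_mono_ae (hi n) (hAC.add (integrable_const _)) hae).trans_eq ?_
        rw [integral_add' hAC (integrable_const _), integral_add hA hC, integral_const_mul,
          integral_const_mul, integral_add hLi (integrable_const ε),
          integral_finsetSum _ fun m _ => hind1 m]
        simp [hind2]
        ring
      refine le_of_forall_gt_imp_ge_of_dense fun b hb => ?_
      refine le_of_tendsto hc ?_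
      filter_upwards [eventually_const_add_mul_le (x := (N : ℝ) + 2) hb, eventually_ge_atTop 1]
        with n h2 h3
      rw [div_le_iff₀ (by exact_mod_cast h3)]
      linarith [hn n]
    have := (hBlim.const_mul 2).const_add ((∫ ω, L ω ∂P) + ε)
    simp only [mul_zero, add_zero] at this
    exact ge_of_tendsto' this hbound
  have hLc : ∀ᵐ ω ∂P, L ω ≤ c := by
    filter_upwards [hup] with ω hω
    refine le_of_forall_gt_imp_ge_of_dense fun b hb => ?_
    exact liminf_le_of_frequently_le (hω b hb).frequently (isBoundedUnder_ge_div h0 h1 ω)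
  have hLeq : ∀ᵐ ω ∂P, L ω = c := by
    refine (integral_eq_iff_of_ae_le hLi (integrable_const c) hLc).mp (le_antisymm ?_ ?_)
    · exact integral_mono_ae hLi (integrable_const c) hLc
    · simpa using hlow
  filter_upwards [hup, hLeq] with ω hω hωL
  refine tendsto_of_le_liminf_of_limsup_le hωL.ge ?_ (isBoundedUnder_le_div h0 h1 ω)
    (isBoundedUnder_ge_div h0 h1 ω)
  refine le_of_forall_gt_imp_ge_of_dense fun b hb => ?_
  exact limsup_le_of_le (isBoundedUnder_ge_div h0 h1 ω).isCoboundedUnder_le (hω b hb)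

end Subadditive

/-! ### The boundary of a triangulation of a polygon -/

/-- Positions of vertices in a slot: the upper vertex, the lower vertices listed from left to right,
and the inner vertices. -/
inductive SlotPos : Type
  | top : SlotPos
  | bottom (t : ℕ) : SlotPos
  | inner (n : ℕ) : SlotPos

namespace PolygonTriangulation

variable {c : ℕ} (T : PolygonTriangulation (c + 2))

open Classical in
/-- The position of a vertex of the filling of a slot. -/
def slotPos (v : T.Vertex) : SlotPos :=
  if h : ∃ t, v = T.boundaryVertex t then
    match Nat.find h with
    | 0 => .bottom c
    | 1 => .top
    | t + 2 => .bottom t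
  else .inner (Quotient.out v : Fin T.m)

/-- The `t`-th dart of the bottom of a slot, from left to right. -/
def bottomDart (t : ℕ) : Fin T.m := (T.next ^ (t + 2)) T.root

/-- The edge carrying the dart `d` belongs to the bottom of the slot. -/
def IsBottom (d : Fin T.m) : Prop := ∃ t < c, T.edge d = T.edge (T.bottomDart t)

theorem next_pow_root_injOn {s t : ℕ} (hs : s < c + 2) (ht : t < c + 2)
    (h : (T.next ^ s) T.root = (T.next ^ t) T.root) : s = t := by
  rw [← T.boundary_degree] at hs ht
  simp only [← Equiv.Perm.iterate_eq_pow] at h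
  exact Function.iterate_injOn_Iio_minimalPeriod hs ht h

theorem boundaryVertex_injOn {s t : ℕ} (hs : s < c + 2) (ht : t < c + 2)
    (h : T.boundaryVertex s = T.boundaryVertex t) : s = t :=
  T.next_pow_root_injOn hs ht <| T.boundary_simple _ _ ⟨s, by simp⟩ ⟨t, by simp⟩ (Quotient.exact h)

theorem next_pow_boundary_degree : (T.next ^ (c + 2)) T.root = T.root := by
  have h := Function.iterate_minimalPeriod (f := T.next) (x := T.root)
  rwa [T.boundary_degree, Equiv.Perm.iterate_eq_pow] at h

theorem next_pow_succ_root_injOn {s t : ℕ} (hs : s < c + 2) (ht : t < c + 2)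
    (h : (T.next ^ (s + 1)) T.root = (T.next ^ (t + 1)) T.root) : s = t := by
  rw [pow_succ', pow_succ'] at h
  exact T.next_pow_root_injOn hs ht (T.next.injective h)

theorem boundaryVertex_boundary_degree : T.boundaryVertex (c + 2) = T.boundaryVertex 0 := by
  simp [boundaryVertex, next_pow_boundary_degree]

theorem origin_flip (d : Fin T.m) : T.origin (T.flip d) = T.origin (T.next d) :=
  Quotient.sound ⟨1, by simp [T.flip_flip]⟩

theorem origin_flip_next_pow_root (t : ℕ) :
    T.origin (T.flip ((T.next ^ t) T.root)) = T.boundaryVertex (t + 1) := by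
  rw [origin_flip, boundaryVertex, pow_succ']
  rfl

open Classical in
theorem find_boundaryVertex {t : ℕ} (ht : t < c + 2)
    (h : ∃ s, T.boundaryVertex t = T.boundaryVertex s) : Nat.find h = t := by
  have h1 : Nat.find h ≤ t := Nat.find_min' h rfl
  exact (T.boundaryVertex_injOn ht (by omega) (Nat.find_spec h)).symm

theorem slotPos_boundaryVertex_zero : T.slotPos (T.boundaryVertex 0) = .bottom c := by
  have h : ∃ s, T.boundaryVertex 0 = T.boundaryVertex s := ⟨_, rfl⟩
  rw [slotPos, dif_pos h, T.find_boundaryVertex (by omega)]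

theorem slotPos_boundaryVertex_one : T.slotPos (T.boundaryVertex 1) = .top := by
  have h : ∃ s, T.boundaryVertex 1 = T.boundaryVertex s := ⟨_, rfl⟩
  rw [slotPos, dif_pos h, T.find_boundaryVertex (by omega)]

theorem slotPos_boundaryVertex_add_two {t : ℕ} (ht : t ≤ c) :
    T.slotPos (T.boundaryVertex (t + 2)) = .bottom t := by
  rcases ht.eq_or_lt with rfl | ht
  · rw [boundaryVertex_boundary_degree, slotPos_boundaryVertex_zero]
  · have h : ∃ s, T.boundaryVertex (t + 2) = T.boundaryVertex s := ⟨_, rfl⟩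
    rw [slotPos, dif_pos h, T.find_boundaryVertex (by omega)]

theorem slotPos_origin_bottomDart {t : ℕ} (ht : t ≤ c) :
    T.slotPos (T.origin (T.bottomDart t)) = .bottom t :=
  T.slotPos_boundaryVertex_add_two ht

theorem slotPos_origin_flip_bottomDart {t : ℕ} (ht : t < c) :
    T.slotPos (T.origin (T.flip (T.bottomDart t))) = .bottom (t + 1) := by
  rw [bottomDart, origin_flip_next_pow_root, T.slotPos_boundaryVertex_add_two ht]

theorem edge_eq_iff {d e : Fin T.m} : T.edge d = T.edge e ↔ d = e ∨ d = T.flip e := by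
  constructor
  · intro h
    obtain ⟨n, hn⟩ : T.flip.SameCycle e d := Quotient.exact h.symm
    have h2 : T.flip ^ (2 : ℤ) = 1 := by
      ext d
      simp [zpow_ofNat, pow_two, T.flip_flip]
    rcases Int.even_or_odd' n with ⟨k, rfl | rfl⟩
    · left
      rw [zpow_mul, h2, one_zpow, Equiv.Perm.one_apply] at hn
      exact hn.symm
    · right
      rw [zpow_add, zpow_mul, h2, one_zpow, one_mul, zpow_one] at hn
      exact hn.symm
  · rintro (rfl | rfl)
    · rfl
    · exact Quotient.sound ⟨1, by simp [T.flip_flip]⟩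

theorem edge_flip (d : Fin T.m) : T.edge (T.flip d) = T.edge d := T.edge_eq_iff.mpr (Or.inr rfl)

/-- If both darts of an edge are on the boundary face, they are consecutive. -/
theorem flip_eq_next_of_boundary {s t : ℕ}
    (h : (T.next ^ t) T.root = T.flip ((T.next ^ s) T.root)) :
    (T.next ^ t) T.root = (T.next ^ (s + 1)) T.root := by
  refine T.boundary_simple _ _ ⟨t, by simp⟩ ⟨(s + 1 : ℕ), by simp only [zpow_natCast]⟩
    (Quotient.exact (s := Equiv.Perm.SameCycle.setoid (T.next * T.flip)) ?_)
  change T.origin _ = T.boundaryVertex (s + 1)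
  rw [h, origin_flip_next_pow_root]

theorem edge_bottomDart_injOn {s t : ℕ} (hs : s < c) (ht : t < c)
    (h : T.edge (T.bottomDart s) = T.edge (T.bottomDart t)) : s = t := by
  rcases T.edge_eq_iff.mp h with h | h
  · have := T.next_pow_root_injOn (by omega) (by omega) h
    omega
  · have h1 := T.flip_eq_next_of_boundary h
    have h' : T.bottomDart t = T.flip (T.bottomDart s) := by rw [h, T.flip_flip]
    have h2 := T.flip_eq_next_of_boundary h'
    -- Two opposite boundary darts would each be the successor of the other, giving `s = t + 1` and
    -- `t = s + 1`.
    have h3 := T.next_pow_succ_root_injOn (by omega) (by omega) h1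
    have h4 := T.next_pow_succ_root_injOn (by omega) (by omega) h2
    omega

/-- This guarantees that the edge between the upper and lower right vertices of a slot belongs to
its row, also when `c = 0` and the two sides of the slot may be glued together. -/
theorem not_isBottom_flip_root : ¬ T.IsBottom (T.flip T.root) := by
  rintro ⟨t, ht, h⟩
  rw [edge_flip] at h
  rcases T.edge_eq_iff.mp h.symm with h | h
  · have := T.next_pow_root_injOn (s := t + 2) (t := 0) (by omega) (by omega) h
    omega
  · have h1 := T.flip_eq_next_of_boundary (s := 0) (t := t + 2) h
    have := T.next_pow_root_injOn (by omega) (by omega) h1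
    omega

/-- A dart of the bottom, in one of the two directions. -/
theorem IsBottom.eq_or_eq {d : Fin T.m} (h : T.IsBottom d) :
    ∃ t < c, d = T.bottomDart t ∨ d = T.flip (T.bottomDart t) := by
  obtain ⟨t, ht, h⟩ := h
  exact ⟨t, ht, T.edge_eq_iff.mp h⟩

theorem edgeLabel_lt (e : T.Edge) : T.edgeLabel e < T.m := (Quotient.out e : Fin T.m).isLt

end PolygonTriangulation

/-! ### First-passage percolation on a field of rows -/

/-- The positions of the vertices of a lower half-plane triangulation. -/
inductive Pos : Type
  | grid (i : ℤ) (k : ℕ) : Pos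
  | inner (i : ℤ) (k : ℕ) (n : ℕ) : Pos

instance : Countable Pos := by
  let f : Pos → (ℤ × ℕ) ⊕ (ℤ × ℕ × ℕ) := fun
    | .grid i k => .inl (i, k)
    | .inner i k n => .inr (i, k, n)
  refine Function.Injective.countable (f := f) ?_
  rintro (⟨i, k⟩ | ⟨i, k, n⟩) (⟨j, l⟩ | ⟨j, l, o⟩) h <;> simp_all [f]

/-- The position of the leftmost child of the individual number `i`, in a generation where the
slots are given by `s`. -/
def firstChild (s : ℤ → Slot) (i : ℤ) : ℤ :=
  ∑ l ∈ Finset.Ico 0 i, ((s l).1 : ℤ) - ∑ l ∈ Finset.Ico i 0, ((s l).1 : ℤ)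

theorem firstChild_succ (s : ℤ → Slot) (i : ℤ) :
    firstChild s (i + 1) = firstChild s i + (s i).1 :=
  Env.childStart_succ (fun i _ => s i) i 0

theorem firstChild_zero (s : ℤ → Slot) : firstChild s 0 = 0 := by simp [firstChild]

/-- The labels of the edges in a row: the horizontal edges at the top of the row, and the edges of
the fillings of the slots. -/
abbrev RowLabel : Type := ℤ ⊕ (ℤ × ℕ)

/-- The slots of a generation, and the weights of the edges of the row, where the horizontal edges
at the bottom of the row are left out. -/
abbrev Row : Type := (ℤ → Slot) × (RowLabel → ℝ)

/-- A sequence of rows. -/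
abbrev Field : Type := ℕ → Row

/-- The vertex at a given position in the slot number `i` of generation `k`, whose
bottom starts at the abscissa `a`. -/
def place (a i : ℤ) (k : ℕ) : SlotPos → Pos
  | .top => .grid i k
  | .bottom t => .grid (a + t) (k + 1)
  | .inner n => .inner i k n

/-- The cost of an edge, as a number in `[κ, 1]`. -/
def cost (κ x : ℝ) : ℝ≥0∞ := ENNReal.ofReal (max κ (min x 1))

theorem measurable_cost (κ : ℝ) : Measurable (cost κ) := by
  unfold cost
  fun_prop

theorem cost_le_one {κ : ℝ} (hκ : κ ≤ 1) (x : ℝ) : cost κ x ≤ 1 := by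
  rw [cost, ← ENNReal.ofReal_one]
  exact ENNReal.ofReal_le_ofReal (max_le hκ (min_le_right _ _))

theorem le_cost (κ x : ℝ) : ENNReal.ofReal κ ≤ cost κ x :=
  ENNReal.ofReal_le_ofReal (le_max_left _ _)

theorem cost_eq {κ x : ℝ} (hx : x ∈ Set.Icc κ 1) : cost κ x = ENNReal.ofReal x := by
  rw [cost, min_eq_left hx.2, max_eq_right hx.1]

/-- `Arc κ R k u v x`: in the row `R` at depth `k`, there is an edge of cost `x` from `u` to `v`. -/
inductive Arc (κ : ℝ) (R : Row) (k : ℕ) : Pos → Pos → ℝ≥0∞ → Prop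
  | right (i : ℤ) : Arc κ R k (.grid i k) (.grid (i + 1) k) (cost κ (R.2 (.inl i)))
  | left (i : ℤ) : Arc κ R k (.grid (i + 1) k) (.grid i k) (cost κ (R.2 (.inl i)))
  | slot (i : ℤ) (d : Fin (R.1 i).2.rep.m) (h : ¬ (R.1 i).2.rep.IsBottom d) :
      Arc κ R k
        (place (firstChild R.1 i) i k ((R.1 i).2.rep.slotPos ((R.1 i).2.rep.origin d)))
        (place (firstChild R.1 i) i k
          ((R.1 i).2.rep.slotPos ((R.1 i).2.rep.origin ((R.1 i).2.rep.flip d))))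
        (cost κ (R.2 (.inr (i, (R.1 i).2.rep.edgeLabel ((R.1 i).2.rep.edge d)))))

theorem Arc.le_one {κ : ℝ} (hκ : κ ≤ 1) {R : Row} {k : ℕ} {u v : Pos} {x : ℝ≥0∞}
    (h : Arc κ R k u v x) : x ≤ 1 := by
  cases h <;> exact cost_le_one hκ _

theorem Arc.le {κ : ℝ} {R : Row} {k : ℕ} {u v : Pos} {x : ℝ≥0∞}
    (h : Arc κ R k u v x) : ENNReal.ofReal κ ≤ x := by
  cases h <;> exact le_cost _ _

/-- The depth of a vertex, rounded up. -/
def Pos.depth : Pos → ℕ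
  | .grid _ k => k
  | .inner _ k _ => k + 1

theorem le_depth_place (a i : ℤ) (k : ℕ) (q : SlotPos) : k ≤ (place a i k q).depth := by
  cases q <;> simp [place, Pos.depth]

theorem depth_place_le (a i : ℤ) (k : ℕ) (q : SlotPos) : (place a i k q).depth ≤ k + 1 := by
  cases q <;> simp [place, Pos.depth]

/-- With inner vertices counted at the lower level of their slot, an edge descends by at most one
level. Each edge costs at least `κ`, whence the linear lower bound on crossings. -/
theorem Arc.depth_le {κ : ℝ} {R : Row} {k : ℕ} {u v : Pos} {x : ℝ≥0∞}
    (h : Arc κ R k u v x) : v.depth ≤ u.depth + 1 := by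
  cases h
  · simp [Pos.depth]
  · simp [Pos.depth]
  · exact (depth_place_le _ _ _ _).trans (by grw [← le_depth_place])

/-- An edge from the upper vertex of a slot to its lower right vertex. -/
theorem exists_arc_down (κ : ℝ) (R : Row) (i : ℤ) (k : ℕ) :
    ∃ x, Arc κ R k (.grid i k) (.grid (firstChild R.1 (i + 1)) (k + 1)) x := by
  have h := Arc.slot (κ := κ) (R := R) (k := k) i ((R.1 i).2.rep.flip (R.1 i).2.rep.root)
    (R.1 i).2.rep.not_isBottom_flip_root
  rw [PolygonTriangulation.flip_flip] at h
  have h1 : (R.1 i).2.rep.origin (R.1 i).2.rep.root = (R.1 i).2.rep.boundaryVertex 0 := rfl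
  have h2 := (R.1 i).2.rep.origin_flip_next_pow_root 0
  rw [pow_zero, Equiv.Perm.one_apply, zero_add] at h2
  rw [h1, h2, PolygonTriangulation.slotPos_boundaryVertex_zero,
    PolygonTriangulation.slotPos_boundaryVertex_one] at h
  rw [firstChild_succ]
  exact ⟨_, h⟩

/-- `Walk κ C n u v x`: there is a path of cost `x` from `u` to `v` in the rows `0, …, n - 1`
of `C`. -/
inductive Walk (κ : ℝ) (C : Field) (n : ℕ) : Pos → Pos → ℝ≥0∞ → Prop
  | nil (u : Pos) : Walk κ C n u u 0
  | cons {k : ℕ} {u v w : Pos} {x y : ℝ≥0∞} (hk : k < n) (h : Arc κ (C k) k u v x)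
      (h' : Walk κ C n v w y) : Walk κ C n u w (x + y)

namespace Walk

variable {κ : ℝ} {C C' : Field} {m n : ℕ} {u v w : Pos} {x y : ℝ≥0∞}

theorem trans (h : Walk κ C n u v x) (h' : Walk κ C n v w y) : Walk κ C n u w (x + y) := by
  induction h with
  | nil u => simpa using h'
  | cons hk h _ ih => rw [add_assoc]; exact .cons hk h (ih h')

theorem mono (h : Walk κ C m u v x) (hmn : m ≤ n) : Walk κ C n u v x := by
  induction h with
  | nil u => exact .nil u
  | cons hk h _ ih => exact .cons (hk.trans_le hmn) h ih

theorem congr (h : Walk κ C n u v x) (hC : ∀ k < n, C k = C' k) : Walk κ C' n u v x := by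
  induction h with
  | nil u => exact .nil u
  | cons hk h _ ih => exact .cons hk (hC _ hk ▸ h) ih

theorem single {k : ℕ} (hk : k < n) (h : Arc κ (C k) k u v x) : Walk κ C n u v x := by
  simpa using Walk.cons hk h (.nil v)

theorem depth_le (h : Walk κ C n u v x) :
    ENNReal.ofReal κ * v.depth ≤ ENNReal.ofReal κ * u.depth + x := by
  induction h with
  | nil u => simp
  | @cons k u v w x y hk h _ ih =>
    have h1 : (v.depth : ℝ≥0∞) ≤ u.depth + 1 := by exact_mod_cast h.depth_le
    calc ENNReal.ofReal κ * w.depth ≤ ENNReal.ofReal κ * v.depth + y := ih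
      _ ≤ ENNReal.ofReal κ * (u.depth + 1) + y := by gcongr
      _ = ENNReal.ofReal κ * u.depth + (ENNReal.ofReal κ + y) := by ring
      _ ≤ ENNReal.ofReal κ * u.depth + (x + y) := by gcongr; exact h.le

end Walk

/-- Follow the right sides of successive slots downwards: one edge, of cost at most `1`, per row. -/
theorem exists_walk_down {κ : ℝ} (hκ : κ ≤ 1) (C : Field) (n : ℕ) :
    ∃ i x, Walk κ C n (.grid 0 0) (.grid i n) x ∧ x ≤ n := by
  induction n with
  | zero => exact ⟨0, 0, .nil _, by simp⟩
  | succ n ih =>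
    obtain ⟨i, x, h, hx⟩ := ih
    obtain ⟨y, hy⟩ := exists_arc_down κ (C n) i n
    refine ⟨_, _, (h.mono (Nat.le_succ n)).trans (.single (Nat.lt_succ_self n) hy), ?_⟩
    push_cast
    exact add_le_add hx (hy.le_one hκ)

/-- The first-passage percolation distance in the rows `0, …, n - 1`. -/
def stripDist (κ : ℝ) (C : Field) (n : ℕ) (u v : Pos) : ℝ≥0∞ :=
  ⨅ (x : ℝ≥0∞) (_ : Walk κ C n u v x), x

/-- The cost of crossing the rows `0, …, n - 1` from the vertex `(0, 0)`. -/
def crossing (κ : ℝ) (C : Field) (n : ℕ) : ℝ≥0∞ :=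
  ⨅ i : ℤ, stripDist κ C n (.grid 0 0) (.grid i n)

/-! ### Locality and linear bounds for crossing costs -/

theorem Walk.stripDist_le {κ : ℝ} {C : Field} {n : ℕ} {u v : Pos} {x : ℝ≥0∞}
    (h : Walk κ C n u v x) : stripDist κ C n u v ≤ x :=
  iInf₂_le x h

theorem Walk.crossing_le {κ : ℝ} {C : Field} {n : ℕ} {i : ℤ} {x : ℝ≥0∞}
    (h : Walk κ C n (.grid 0 0) (.grid i n) x) : crossing κ C n ≤ x :=
  (iInf_le _ i).trans h.stripDist_le

theorem stripDist_congr {κ : ℝ} {C C' : Field} {n : ℕ} (hC : ∀ k < n, C k = C' k) (u v : Pos) :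
    stripDist κ C n u v = stripDist κ C' n u v := by
  refine le_antisymm ?_ ?_ <;> refine le_iInf₂ fun x h => Walk.stripDist_le (h.congr ?_)
  · exact fun k hk => (hC k hk).symm
  · exact hC

theorem crossing_congr {κ : ℝ} {C C' : Field} {n : ℕ} (hC : ∀ k < n, C k = C' k) :
    crossing κ C n = crossing κ C' n := by
  simp only [crossing, stripDist_congr hC]

theorem crossing_le {κ : ℝ} (hκ : κ ≤ 1) (C : Field) (n : ℕ) : crossing κ C n ≤ n := by
  obtain ⟨i, x, h, hx⟩ := exists_walk_down hκ C n
  exact h.crossing_le.trans hx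

theorem crossing_ne_top {κ : ℝ} (hκ : κ ≤ 1) (C : Field) (n : ℕ) : crossing κ C n ≠ ⊤ :=
  ((crossing_le hκ C n).trans_lt (ENNReal.natCast_lt_top n)).ne

theorem le_crossing (κ : ℝ) (C : Field) (n : ℕ) : ENNReal.ofReal κ * n ≤ crossing κ C n := by
  refine le_iInf fun i => le_iInf₂ fun x h => ?_
  simpa [Pos.depth] using h.depth_le

/-! #### Measurability -/

/-- The smallest cost of an edge of a row between two vertices. -/
def arcCost (κ : ℝ) (R : Row) (k : ℕ) (u v : Pos) : ℝ≥0∞ := ⨅ (x : ℝ≥0∞) (_ : Arc κ R k u v x), x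

/-- In a slot `s`, number `i` of generation `k`, whose bottom starts at the abscissa `a`, the edge
labelled by `n` goes from `u` to `v`. -/
def SlotArc (s : Slot) (a i : ℤ) (k : ℕ) (u v : Pos) (n : ℕ) : Prop :=
  ∃ d : Fin s.2.rep.m, ¬ s.2.rep.IsBottom d ∧ u = place a i k (s.2.rep.slotPos (s.2.rep.origin d)) ∧
    v = place a i k (s.2.rep.slotPos (s.2.rep.origin (s.2.rep.flip d))) ∧
    n = s.2.rep.edgeLabel (s.2.rep.edge d)

open Classical in
theorem arcCost_eq (κ : ℝ) (R : Row) (k : ℕ) (u v : Pos) :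
    arcCost κ R k u v =
      (⨅ i : ℤ, if (u = .grid i k ∧ v = .grid (i + 1) k) ∨ (u = .grid (i + 1) k ∧ v = .grid i k)
        then cost κ (R.2 (.inl i)) else ⊤) ⊓
      ⨅ (i : ℤ) (n : ℕ), if SlotArc (R.1 i) (firstChild R.1 i) i k u v n
        then cost κ (R.2 (.inr (i, n))) else ⊤ := by
  refine le_antisymm (le_inf (le_iInf fun i => ?_) (le_iInf₂ fun i n => ?_)) ?_
  · split_ifs with h
    · rcases h with ⟨rfl, rfl⟩ | ⟨rfl, rfl⟩
      · exact iInf₂_le _ (Arc.right i)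
      · exact iInf₂_le _ (Arc.left i)
    · exact le_top
  · split_ifs with h
    · obtain ⟨d, hd, rfl, rfl, rfl⟩ := h
      exact iInf₂_le _ (Arc.slot i d hd)
    · exact le_top
  · refine le_iInf₂ fun x h => ?_
    cases h with
    | right i => exact inf_le_left.trans ((iInf_le _ i).trans_eq (if_pos (Or.inl ⟨rfl, rfl⟩)))
    | left i => exact inf_le_left.trans ((iInf_le _ i).trans_eq (if_pos (Or.inr ⟨rfl, rfl⟩)))
    | slot i d hd =>
      exact inf_le_right.trans ((iInf₂_le i _).trans_eq (if_pos ⟨d, hd, rfl, rfl, rfl⟩))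

theorem measurable_firstChild (i : ℤ) : Measurable fun s : ℤ → Slot => firstChild s i := by
  have h : ∀ l : ℤ, Measurable fun s : ℤ → Slot => ((s l).1 : ℤ) := fun l =>
    (measurable_from_top (f := fun s : Slot => (s.1 : ℤ))).comp (measurable_pi_apply l)
  exact (Finset.measurable_fun_sum _ fun l _ => h l).sub (Finset.measurable_fun_sum _ fun l _ => h l)

theorem measurableSet_slotArc (i : ℤ) (k : ℕ) (u v : Pos) (n : ℕ) :
    MeasurableSet {s : ℤ → Slot | SlotArc (s i) (firstChild s i) i k u v n} := by
  have h : {s : ℤ → Slot | SlotArc (s i) (firstChild s i) i k u v n} =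
      ⋃ a : ℤ, (fun s : ℤ → Slot => firstChild s i) ⁻¹' {a} ∩
        (fun s : ℤ → Slot => s i) ⁻¹' {t | SlotArc t a i k u v n} := by
    ext s
    simp
  rw [h]
  exact MeasurableSet.iUnion fun a =>
    (measurable_firstChild i (measurableSet_singleton a)).inter (measurable_pi_apply i trivial)

theorem measurable_arcCost (κ : ℝ) (k : ℕ) (u v : Pos) :
    Measurable fun R : Row => arcCost κ R k u v := by
  classical
  simp only [arcCost_eq]
  refine Measurable.min (Measurable.iInf fun i => ?_)
    (Measurable.iInf fun i => Measurable.iInf fun n => ?_)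
  · split_ifs
    · exact (measurable_cost κ).comp ((measurable_pi_apply _).comp measurable_snd)
    · exact measurable_const
  · exact Measurable.ite (measurable_fst (measurableSet_slotArc i k u v n))
      ((measurable_cost κ).comp ((measurable_pi_apply _).comp measurable_snd)) measurable_const

open Classical in
/-- The smallest cost of a path with a given number of edges. -/
def stepDist (κ : ℝ) (C : Field) (n : ℕ) : ℕ → Pos → Pos → ℝ≥0∞
  | 0, u, v => if u = v then 0 else ⊤
  | j + 1, u, v => ⨅ (k : ℕ) (_ : k < n) (w : Pos), arcCost κ (C k) k u w + stepDist κ C n j w v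

/-- Sorting the walks by their number of steps turns the infimum over walks into countable infima of
measurable functions, as there are countably many positions. -/
theorem stripDist_eq_iInf_stepDist (κ : ℝ) (C : Field) (n : ℕ) (u v : Pos) :
    stripDist κ C n u v = ⨅ j, stepDist κ C n j u v := by
  refine le_antisymm (le_iInf fun j => ?_) (le_iInf₂ fun x h => ?_)
  · induction j generalizing u with
    | zero =>
      rw [stepDist]
      split_ifs with huv
      · subst huv
        exact (Walk.nil u).stripDist_le
      · exact le_top
    | succ j ih =>
      refine le_iInf₂ fun k hk => le_iInf fun w => ?_
      refine le_trans ?_ (add_le_add_right (ih w) _)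
      simp only [arcCost, stripDist, ENNReal.iInf_add, ENNReal.add_iInf]
      exact le_iInf₂ fun y hy => le_iInf₂ fun x hx => Walk.stripDist_le (.cons hk hx hy)
  · induction h with
    | nil u => exact iInf_le_of_le 0 (by simp [stepDist])
    | @cons k u v w x y hk h _ ih =>
      refine le_trans ?_ (add_le_add_right ih x)
      rw [ENNReal.add_iInf]
      refine le_iInf fun j => iInf_le_of_le (j + 1) ?_
      refine (iInf₂_le_of_le k hk (iInf_le _ v)).trans ?_
      gcongr
      exact iInf₂_le x h

theorem measurable_stepDist (κ : ℝ) (n j : ℕ) (u v : Pos) :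
    Measurable fun C : Field => stepDist κ C n j u v := by
  induction j generalizing u with
  | zero => exact measurable_const
  | succ j ih =>
    refine Measurable.iInf fun k => Measurable.iInf fun _ => Measurable.iInf fun w => ?_
    exact ((measurable_arcCost κ k u w).comp (measurable_pi_apply k)).add (ih w)

theorem measurable_stripDist (κ : ℝ) (n : ℕ) (u v : Pos) :
    Measurable fun C : Field => stripDist κ C n u v := by
  simp only [stripDist_eq_iInf_stepDist]
  exact Measurable.iInf fun j => measurable_stepDist κ n j u v

theorem measurable_crossing (κ : ℝ) (n : ℕ) : Measurable fun C : Field => crossing κ C n :=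
  Measurable.iInf fun _ => measurable_stripDist κ n _ _

/-! #### Translations -/

/-- The horizontal translation of a row. -/
def shiftRow (a : ℤ) (R : Row) : Row :=
  (fun i => R.1 (i + a), fun l => R.2 (l.map (· + a) (Prod.map (· + a) id)))

/-- Translating a generation by `a` translates the next one by `firstChild s a`, because the
numbering of the children is pinned at individual `0`. This cocycle relation is what dictates the
recursion in `offset`. -/
theorem firstChild_shift (s : ℤ → Slot) (a i : ℤ) :
    firstChild (fun i => s (i + a)) i + firstChild s a = firstChild s (i + a) := by
  induction i using Int.induction_on with
  | zero => simp [firstChild_zero]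
  | succ i ih =>
    rw [firstChild_succ, show (i : ℤ) + 1 + a = i + a + 1 by ring, firstChild_succ, ← ih]
    ring
  | pred i ih =>
    have h1 := firstChild_succ (fun i => s (i + a)) (-(i : ℤ) - 1)
    have h2 := firstChild_succ s (-(i : ℤ) - 1 + a)
    rw [sub_add_cancel] at h1
    rw [show -(i : ℤ) - 1 + a + 1 = -i + a by ring] at h2
    linarith

/-- The abscissae of the vertices that become the vertices `(0, k)` if `(a, 0)` becomes the
origin. -/
def offset (C : Field) (a : ℤ) : ℕ → ℤ
  | 0 => a
  | k + 1 => firstChild (C k).1 (offset C a k)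

/-- The field obtained if the vertex `(a, 0)` becomes the origin. -/
def reroot (a : ℤ) (C : Field) : Field := fun k => shiftRow (offset C a k) (C k)

/-- The field of the rows `m, m + 1, …`. -/
def tail (m : ℕ) (C : Field) : Field := fun k => C (m + k)

/-- The effect of a change of origin on the vertices. -/
def Pos.shift (o : ℕ → ℤ) (m : ℕ) : Pos → Pos
  | .grid i k => .grid (i + o k) (m + k)
  | .inner i k n => .inner (i + o k) (m + k) n

theorem shift_place {R : Row} {o : ℕ → ℤ} {k : ℕ} (ho : o (k + 1) = firstChild R.1 (o k))
    (i : ℤ) (m : ℕ) (q : SlotPos) :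
    (place (firstChild (shiftRow (o k) R).1 i) i k q).shift o m =
      place (firstChild R.1 (i + o k)) (i + o k) (m + k) q := by
  have h := firstChild_shift R.1 (o k) i
  rw [← ho] at h
  rcases q with _ | t | n
  · rfl
  · simp only [place, Pos.shift, ← h, shiftRow]
    congr 1
    ring
  · rfl

theorem Arc.shift {κ : ℝ} {R : Row} {o : ℕ → ℤ} {k : ℕ} (ho : o (k + 1) = firstChild R.1 (o k))
    (m : ℕ) {u v : Pos} {x : ℝ≥0∞} (h : Arc κ (shiftRow (o k) R) k u v x) :
    Arc κ R (m + k) (u.shift o m) (v.shift o m) x := by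
  cases h with
  | right i =>
    have := Arc.right (κ := κ) (R := R) (k := m + k) (i + o k)
    rwa [add_right_comm] at this
  | left i =>
    have := Arc.left (κ := κ) (R := R) (k := m + k) (i + o k)
    rwa [add_right_comm] at this
  | slot i d hd =>
    rw [shift_place ho, shift_place ho]
    exact Arc.slot (R := R) (i + o k) d hd

theorem Walk.shift {κ : ℝ} {C : Field} {a : ℤ} {m n : ℕ} {u v : Pos} {x : ℝ≥0∞}
    (h : Walk κ (reroot a (tail m C)) n u v x) :
    Walk κ C (m + n) (u.shift (offset (tail m C) a) m) (v.shift (offset (tail m C) a) m) x := by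
  induction h with
  | nil u => exact .nil _
  | @cons k u v w x y hk h _ ih =>
    exact .cons (Nat.add_lt_add_left hk m)
      (Arc.shift (R := C (m + k)) (o := offset (tail m C) a) rfl m h) ih

/-- Concatenate a walk to `(a, m)` in the first `m` rows with a crossing of the next `n` rows
started there. -/
theorem crossing_add_le (κ : ℝ) (C : Field) (m n : ℕ) (a : ℤ) :
    crossing κ C (m + n) ≤
      stripDist κ C m (.grid 0 0) (.grid a m) + crossing κ (reroot a (tail m C)) n := by
  simp only [crossing, stripDist, ENNReal.iInf_add, ENNReal.add_iInf]
  refine le_iInf fun i => le_iInf₂ fun y hy => le_iInf₂ fun x hx => ?_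
  have h := hy.shift
  simp only [Pos.shift, offset, zero_add, add_zero] at h
  exact ((hx.mono (Nat.le_add_right m n)).trans h).crossing_le

/-! #### The regeneration point -/

/-- The slack `1` avoids asking whether the infimum is attained. Enumerating `ℤ` lets the first
suitable vertex be selected, measurably and from the first `m` rows only. -/
theorem exists_stripDist_le {κ : ℝ} (hκ : κ ≤ 1) (C : Field) (m : ℕ) :
    ∃ n : ℕ, stripDist κ C m (.grid 0 0) (.grid (Denumerable.ofNat ℤ n) m) ≤
      crossing κ C m + 1 := by
  have h : crossing κ C m < crossing κ C m + 1 :=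
    ENNReal.lt_add_right (crossing_ne_top hκ C m) one_ne_zero
  obtain ⟨i, hi⟩ := iInf_lt_iff.mp h
  exact ⟨Encodable.encode i, by rw [Denumerable.ofNat_encode]; exact hi.le⟩

open Classical in
/-- A vertex at depth `m` which is almost as close to the origin as the line at depth `m`. -/
def landing {κ : ℝ} (hκ : κ ≤ 1) (C : Field) (m : ℕ) : ℤ :=
  Denumerable.ofNat ℤ (Nat.find (exists_stripDist_le hκ C m))

theorem stripDist_landing_le {κ : ℝ} (hκ : κ ≤ 1) (C : Field) (m : ℕ) :
    stripDist κ C m (.grid 0 0) (.grid (landing hκ C m) m) ≤ crossing κ C m + 1 :=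
  Nat.find_spec (exists_stripDist_le hκ C m)

theorem landing_congr {κ : ℝ} (hκ : κ ≤ 1) {C C' : Field} {m : ℕ} (hC : ∀ k < m, C k = C' k) :
    landing hκ C m = landing hκ C' m := by
  simp only [landing, stripDist_congr hC, crossing_congr hC]

theorem measurable_landing {κ : ℝ} (hκ : κ ≤ 1) (m : ℕ) :
    Measurable fun C : Field => landing hκ C m := by
  classical
  exact (measurable_from_top (f := Denumerable.ofNat ℤ)).comp
    (measurable_find (fun C : Field => exists_stripDist_le hκ C m) fun k =>
      measurableSet_le (measurable_stripDist κ m _ _) ((measurable_crossing κ m).add_const 1))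

/-- The field seen from the landing vertex at depth `m`. -/
def regenerate {κ : ℝ} (hκ : κ ≤ 1) (m : ℕ) (C : Field) : Field :=
  reroot (landing hκ C m) (tail m C)

/-- Adding `1` to `crossing` absorbs the slack in the choice of the landing vertex. -/
theorem crossing_add_one_subadditive {κ : ℝ} (hκ : κ ≤ 1) (C : Field) (m n : ℕ) :
    crossing κ C (m + n) + 1 ≤
      (crossing κ C m + 1) + (crossing κ (regenerate hκ m C) n + 1) := by
  rw [← add_assoc]
  gcongr
  exact (crossing_add_le κ C m n (landing hκ C m)).trans
    (add_le_add_left (stripDist_landing_le hκ C m) _)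

theorem offset_congr {C C' : Field} {n : ℕ} (hC : ∀ k < n, C k = C' k) (a : ℤ) :
    ∀ k ≤ n, offset C a k = offset C' a k := by
  intro k hk
  induction k with
  | zero => rfl
  | succ k ih => rw [offset, offset, ih (by omega), hC k (by omega)]

theorem regenerate_congr {κ : ℝ} (hκ : κ ≤ 1) {C C' : Field} {m n : ℕ}
    (hC : ∀ k < m + n, C k = C' k) : ∀ k < n, regenerate hκ m C k = regenerate hκ m C' k := by
  intro k hk
  have h : ∀ k < n, tail m C k = tail m C' k := fun k hk => hC _ (by omega)
  rw [regenerate, regenerate, reroot, reroot, landing_congr hκ fun k hk => hC k (by omega),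
    offset_congr h _ k hk.le, h k hk]

/-! ### Independent rows -/

/-- The coordinates of a pair of independent i.i.d. families form an i.i.d. family of pairs. -/
theorem measurePreserving_zip {ι α β : Type*} [MeasurableSpace α] [MeasurableSpace β]
    (A : Measure α) [IsProbabilityMeasure A] (B : Measure β) [IsProbabilityMeasure B] :
    MeasurePreserving (fun (p : (ι → α) × (ι → β)) i => (p.1 i, p.2 i))
      ((Measure.infinitePi fun _ => A).prod (Measure.infinitePi fun _ => B))
      (Measure.infinitePi fun _ => A.prod B) := by
  set P := (Measure.infinitePi fun _ : ι => A).prod (Measure.infinitePi fun _ : ι => B)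
  have hm : ∀ i : ι, Measurable fun p : (ι → α) × (ι → β) => (p.1 i, p.2 i) := fun i => by fun_prop
  have hmap : ∀ i : ι, P.map (fun p : (ι → α) × (ι → β) => (p.1 i, p.2 i)) = A.prod B := fun i =>
    ((measurePreserving_eval_infinitePi (fun _ : ι => A) i).prod
      (measurePreserving_eval_infinitePi (fun _ : ι => B) i)).map_eq
  refine ⟨by fun_prop, ?_⟩
  have hind : iIndepFun (fun (i : ι) (p : (ι → α) × (ι → β)) => (p.1 i, p.2 i)) P := by
    rw [iIndepFun_iff_iIndep]
    -- It suffices to test independence on rectangles, for which a finite intersection is again a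
    -- product of an event on the first family and one on the second.
    refine iIndepSets.iIndep (fun i => (hm i).comap_le)
      (fun i => {s | ∃ t ∈ Set.image2 (· ×ˢ ·) {a : Set α | MeasurableSet a}
        {b : Set β | MeasurableSet b}, (fun p : (ι → α) × (ι → β) => (p.1 i, p.2 i)) ⁻¹' t = s})
      (fun i => isPiSystem_prod.comap _) (fun i => ?_) ?_
    · rw [← generateFrom_prod, MeasurableSpace.comap_generateFrom]
      rfl
    · rw [iIndepSets_iff]
      intro S f hf
      choose! t ht htf using hf
      choose! a ha b hb hab using ht
      have h1 : ⋂ i ∈ S, f i = (S : Set ι).pi a ×ˢ (S : Set ι).pi b := by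
        ext p
        simp only [Set.mem_iInter, Set.mem_prod, Set.mem_pi, Finset.mem_coe]
        rw [← forall₂_and]
        refine forall₂_congr fun i hi => ?_
        rw [← htf i hi, ← hab i hi]
        simp
      have h2 : ∀ i ∈ S, P (f i) = A (a i) * B (b i) := fun i hi => by
        rw [← Measure.prod_prod, ← hmap i, Measure.map_apply (hm i) ((ha i hi).prod (hb i hi)),
          ← htf i hi, ← hab i hi]
      rw [h1, Measure.prod_prod, Measure.infinitePi_pi _ ha, Measure.infinitePi_pi _ hb,
        ← Finset.prod_mul_distrib]
      exact (Finset.prod_congr rfl h2).symm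
  rw [(iIndepFun_iff_map_fun_eq_infinitePi_map hm).mp hind]
  simp only [hmap]

/-! ### The law of the field of rows -/

theorem measurable_tail (m : ℕ) : Measurable (tail m) :=
  measurable_pi_iff.mpr fun k => measurable_pi_apply (m + k)

/-- The field whose rows `m, m + 1, …` have been replaced by `R`. -/
def truncate (R : Row) (m : ℕ) (C : Field) : Field := fun k => if k < m then C k else R

theorem measurable_truncate (R : Row) (m : ℕ) : Measurable (truncate R m) := by
  refine measurable_pi_iff.mpr fun k => ?_
  unfold truncate
  split_ifs
  · exact measurable_pi_apply k
  · exact measurable_const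

theorem truncate_apply (R : Row) {m k : ℕ} (hk : k < m) (C : Field) : C k = truncate R m C k :=
  (if_pos hk).symm

theorem measurable_firstChild_uncurry :
    Measurable fun p : ℤ × (ℤ → Slot) => firstChild p.2 p.1 :=
  measurable_from_prod_countable_right fun i => measurable_firstChild i

theorem measurable_shiftRow (a : ℤ) : Measurable (shiftRow a) :=
  (measurable_pi_iff.mpr fun i => (measurable_pi_apply (i + a)).comp measurable_fst).prodMk
    (measurable_pi_iff.mpr fun _ => (measurable_pi_apply _).comp measurable_snd)

theorem measurable_shiftRow_uncurry : Measurable fun p : ℤ × Row => shiftRow p.1 p.2 :=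
  measurable_from_prod_countable_right measurable_shiftRow

theorem measurable_offset (a : ℤ) (k : ℕ) : Measurable fun C : Field => offset C a k := by
  induction k with
  | zero => exact measurable_const
  | succ k ih =>
    have h : Measurable fun C : Field => (offset C a k, (C k).1) :=
      ih.prodMk (measurable_fst.comp (measurable_pi_apply k))
    have h2 := measurable_firstChild_uncurry.comp h
    simp only [Function.comp_def] at h2
    exact h2

theorem measurable_reroot (a : ℤ) : Measurable (reroot a) := by
  refine measurable_pi_iff.mpr fun k => ?_
  have h : Measurable fun C : Field => (offset C a k, C k) :=
    (measurable_offset a k).prodMk (measurable_pi_apply k)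
  exact measurable_shiftRow_uncurry.comp h

theorem measurable_reroot_uncurry : Measurable fun p : ℤ × Field => reroot p.1 p.2 :=
  measurable_from_prod_countable_right measurable_reroot

theorem offset_succ (C : Field) (a : ℤ) (k : ℕ) :
    offset C a (k + 1) = offset (tail 1 C) (firstChild (C 0).1 a) k := by
  induction k with
  | zero => rfl
  | succ k ih => rw [offset, ih, offset, tail, add_comm 1 k]

theorem reroot_succ (C : Field) (a : ℤ) (k : ℕ) :
    reroot a C (k + 1) = reroot (firstChild (C 0).1 a) (tail 1 C) k := by
  rw [reroot, reroot, offset_succ, tail, add_comm 1 k]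

section FieldLaw

variable [IsProbabilityMeasure slotLaw] (μ : Measure ℝ) [IsProbabilityMeasure μ]

/-- The law of a row. -/
def rowLaw : Measure Row :=
  (Measure.infinitePi fun _ : ℤ => slotLaw).prod (Measure.infinitePi fun _ : RowLabel => μ)

instance : IsProbabilityMeasure (rowLaw μ) := by unfold rowLaw; infer_instance

/-- The law of a sequence of independent rows. -/
def fieldLaw : Measure Field := Measure.infinitePi fun _ : ℕ => rowLaw μ

instance : IsProbabilityMeasure (fieldLaw μ) := by unfold fieldLaw; infer_instance

theorem measurePreserving_shiftRow (a : ℤ) :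
    MeasurePreserving (shiftRow a) (rowLaw μ) (rowLaw μ) := by
  refine MeasurePreserving.prod (f := fun s : ℤ → Slot => fun i => s (i + a))
    (g := fun w : RowLabel → ℝ => fun l : RowLabel => w (Sum.map (· + a) (Prod.map (· + a) id) l))
    ⟨by fun_prop, ?_⟩ ⟨by fun_prop, ?_⟩
  · exact Measure.map_infinitePi_infinitePi_of_inj (P := fun _ : ℤ => slotLaw)
      (add_left_injective a)
  · refine Measure.map_infinitePi_infinitePi_of_inj (P := fun _ : RowLabel => μ)
      (Function.Injective.sumMap (add_left_injective a) ?_)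
    exact (add_left_injective a).prodMap Function.injective_id

theorem measurePreserving_tail (m : ℕ) : MeasurePreserving (tail m) (fieldLaw μ) (fieldLaw μ) :=
  ⟨measurable_tail m, Measure.map_infinitePi_infinitePi_of_inj (P := fun _ : ℕ => rowLaw μ)
    (f := fun k => m + k) (add_right_injective m)⟩

theorem indepFun_truncate_tail (R : Row) (m : ℕ) :
    IndepFun (truncate R m) (tail m) (fieldLaw μ) := by
  have h : iIndepFun (fun (k : ℕ) (C : Field) => C k) (fieldLaw μ) :=
    iIndepFun_infinitePi (X := fun _ R => R) fun _ => measurable_id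
  rw [iIndepFun_iff_iIndep] at h
  have h2 := indep_iSup_of_disjoint (fun k => (measurable_pi_apply k).comap_le) h
    (S := {k | k < m}) (T := {k | m ≤ k})
    (Set.disjoint_left.mpr fun k (hk : k < m) (hk' : m ≤ k) => by omega)
  rw [IndepFun_iff_Indep]
  refine indep_of_indep_of_le_left (indep_of_indep_of_le_right h2 ?_) ?_
  · rw [← measurable_iff_comap_le, @measurable_pi_iff]
    intro k
    exact (comap_measurable _).mono (le_iSup₂_of_le (m + k) (Nat.le_add_right m k) le_rfl) le_rfl
  · rw [← measurable_iff_comap_le, @measurable_pi_iff]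
    intro k
    unfold truncate
    split_ifs with hk
    · exact (comap_measurable _).mono (le_iSup₂_of_le k hk le_rfl) le_rfl
    · exact measurable_const

theorem measurePreserving_truncate_tail (R : Row) (m : ℕ) :
    MeasurePreserving (fun C => (truncate R m C, tail m C)) (fieldLaw μ)
      (((fieldLaw μ).map (truncate R m)).prod (fieldLaw μ)) := by
  refine ⟨(measurable_truncate R m).prodMk (measurable_tail m), ?_⟩
  rw [(indepFun_truncate_tail μ R m).map_prod_eq_prod_map_map
    (measurable_truncate R m).aemeasurable (measurable_tail m).aemeasurable,
    (measurePreserving_tail μ m).map_eq]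

theorem measurePreserving_zero_tail :
    MeasurePreserving (fun C : Field => (C 0, tail 1 C)) (fieldLaw μ)
      ((rowLaw μ).prod (fieldLaw μ)) := by
  obtain ⟨R⟩ : Nonempty Row := (rowLaw μ).nonempty_of_neZero
  refine ⟨(measurable_pi_apply 0).prodMk (measurable_tail 1), ?_⟩
  have h := (indepFun_truncate_tail μ R 1).comp (measurable_pi_apply 0) measurable_id
  have h2 : (fun C : Field => C 0) ∘ truncate R 1 = fun C => C 0 := rfl
  rw [h2, Function.id_comp] at h
  rw [h.map_prod_eq_prod_map_map (measurable_pi_apply 0).aemeasurable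
    (measurable_tail 1).aemeasurable, (measurePreserving_tail μ 1).map_eq]
  congr 1
  exact (measurePreserving_eval_infinitePi (fun _ : ℕ => rowLaw μ) 0).map_eq

/-- Condition on the first row. The lower rows are then rerooted at the abscissa `firstChild (C 0).1
a`, which has become deterministic, and by induction their probability does not depend on it. The
first row contributes its own factor by translation invariance. -/
theorem fieldLaw_reroot_cylinder (n : ℕ) (a : ℤ) (t : ℕ → Set Row)
    (ht : ∀ k, MeasurableSet (t k)) :
    fieldLaw μ {C | ∀ k < n, reroot a C k ∈ t k} = ∏ k ∈ Finset.range n, rowLaw μ (t k) := by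
  induction n generalizing a t with
  | zero => simp
  | succ n ih =>
    have hE : MeasurableSet {p : ℤ × Field | ∀ k < n, reroot p.1 p.2 k ∈ t (k + 1)} := by
      simp only [Set.ofPred_forall]
      exact MeasurableSet.iInter fun k => MeasurableSet.iInter fun _ =>
        ((measurable_pi_apply k).comp measurable_reroot_uncurry) (ht (k + 1))
    have hF : MeasurableSet {p : Row × Field | shiftRow a p.1 ∈ t 0 ∧
        ∀ k < n, reroot (firstChild p.1.1 a) p.2 k ∈ t (k + 1)} := by
      refine MeasurableSet.inter
        (((measurePreserving_shiftRow μ a).measurable.comp measurable_fst) (ht 0)) ?_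
      exact (((measurable_firstChild a).comp (measurable_fst.comp measurable_fst)).prodMk
        measurable_snd) hE
    have hset : {C : Field | ∀ k < n + 1, reroot a C k ∈ t k} =
        (fun C : Field => (C 0, tail 1 C)) ⁻¹' {p : Row × Field | shiftRow a p.1 ∈ t 0 ∧
          ∀ k < n, reroot (firstChild p.1.1 a) p.2 k ∈ t (k + 1)} := by
      ext C
      simp only [Set.mem_ofPred_eq, Set.mem_preimage, ← reroot_succ]
      constructor
      · exact fun h => ⟨h 0 (by omega), fun k hk => h (k + 1) (by omega)⟩
      · rintro ⟨h0, h⟩ (_ | k) hk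
        · exact h0
        · exact h k (by omega)
    rw [hset, (measurePreserving_zero_tail μ).measure_preimage hF.nullMeasurableSet,
      Measure.prod_apply hF]
    have hsec : ∀ R : Row, fieldLaw μ (Prod.mk R ⁻¹' {p : Row × Field | shiftRow a p.1 ∈ t 0 ∧
        ∀ k < n, reroot (firstChild p.1.1 a) p.2 k ∈ t (k + 1)}) =
        (shiftRow a ⁻¹' t 0).indicator
          (fun _ => ∏ k ∈ Finset.range n, rowLaw μ (t (k + 1))) R := by
      intro R
      by_cases hR : shiftRow a R ∈ t 0
      · rw [Set.indicator_of_mem (by exact hR), ← ih (firstChild R.1 a) _ fun k => ht (k + 1)]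
        congr 1
        ext C
        simp [hR]
      · rw [Set.indicator_of_notMem (by exact hR)]
        simp [hR]
    simp only [hsec]
    rw [lintegral_indicator_const ((measurePreserving_shiftRow μ a).measurable (ht 0)),
      (measurePreserving_shiftRow μ a).measure_preimage (ht 0).nullMeasurableSet,
      Finset.prod_range_succ', ]

/-- The law of the field of rows does not depend on the origin. -/
theorem measurePreserving_reroot (a : ℤ) :
    MeasurePreserving (reroot a) (fieldLaw μ) (fieldLaw μ) := by
  refine ⟨measurable_reroot a, Measure.eq_infinitePi _ fun s t ht => ?_⟩
  classical
  obtain ⟨n, hn⟩ : ∃ n, s ⊆ Finset.range n := s.exists_nat_subset_range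
  -- Unconstrained rows are padded with the whole space, so that the constraints bear on an initial
  -- segment.
  let t' : ℕ → Set Row := fun k => if k ∈ s then t k else Set.univ
  have ht' : ∀ k, MeasurableSet (t' k) := fun k => by
    simp only [t']
    split_ifs
    exacts [ht k, MeasurableSet.univ]
  have h := fieldLaw_reroot_cylinder μ n a t' ht'
  have hset : reroot a ⁻¹' (s : Set ℕ).pi t = {C | ∀ k < n, reroot a C k ∈ t' k} := by
    ext C
    simp only [Set.mem_preimage, Set.mem_pi, Finset.mem_coe, Set.mem_ofPred_eq, t']
    constructor
    · intro hC k _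
      split_ifs with hk
      exacts [hC k hk, Set.mem_univ _]
    · intro hC k hk
      simpa [hk] using hC k (Finset.mem_range.mp (hn hk))
  rw [Measure.map_apply (measurable_reroot a) (.pi s.countable_toSet fun k _ => ht k), hset, h,
    ← Finset.prod_subset hn fun k _ hk => by simp [t', hk]]
  exact Finset.prod_congr rfl fun k hk => by simp [t', hk]

/-- Below the landing vertex at depth `m`, the field is distributed as the original one, and it is
independent of the rows above. -/
theorem measurePreserving_truncate_regenerate {κ : ℝ} (hκ : κ ≤ 1) (R : Row) (m : ℕ) :
    MeasurePreserving (fun C => (truncate R m C, regenerate hκ m C)) (fieldLaw μ)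
      (((fieldLaw μ).map (truncate R m)).prod (fieldLaw μ)) := by
  -- With the upper rows frozen, the landing vertex is fixed and rerooting there preserves the law
  -- of the lower rows.
  have h := MeasurePreserving.skew_product (μc := fieldLaw μ) (μd := fieldLaw μ)
    (MeasurePreserving.id ((fieldLaw μ).map (truncate R m)))
    (g := fun T C => reroot (landing hκ T m) C)
    (measurable_reroot_uncurry.comp
      (((measurable_landing hκ m).comp measurable_fst).prodMk measurable_snd))
    (ae_of_all _ fun T => (measurePreserving_reroot μ _).map_eq)
  have heq : (fun C => (truncate R m C, regenerate hκ m C)) =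
      (fun p : Field × Field => (id p.1, reroot (landing hκ p.1 m) p.2)) ∘
        fun C => (truncate R m C, tail m C) := by
    ext1 C
    simp only [regenerate, Function.comp_apply, id,
      landing_congr hκ fun k hk => truncate_apply R hk C]
  rw [heq]
  exact h.comp (measurePreserving_truncate_tail μ R m)

theorem measurePreserving_regenerate {κ : ℝ} (hκ : κ ≤ 1) (m : ℕ) :
    MeasurePreserving (regenerate hκ m) (fieldLaw μ) (fieldLaw μ) := by
  obtain ⟨R⟩ : Nonempty Row := (rowLaw μ).nonempty_of_neZero
  have := Measure.isProbabilityMeasure_map (μ := fieldLaw μ)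
    (measurable_truncate R m).aemeasurable
  exact measurePreserving_snd.comp (measurePreserving_truncate_regenerate μ hκ R m)

theorem indepFun_truncate_regenerate {κ : ℝ} (hκ : κ ≤ 1) (R : Row) (m : ℕ) :
    IndepFun (truncate R m) (regenerate hκ m) (fieldLaw μ) := by
  rw [indepFun_iff_map_prod_eq_prod_map_map (measurable_truncate R m).aemeasurable
    (measurePreserving_regenerate μ hκ m).measurable.aemeasurable,
    (measurePreserving_regenerate μ hκ m).map_eq]
  exact (measurePreserving_truncate_regenerate μ hκ R m).map_eq

/-- Block `i` only reads rows above depth `i * k + k ≤ j * k`, while block `j` is a function of the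
field regenerated at depth `j * k`. -/
theorem indepFun_blocks {κ : ℝ} (hκ : κ ≤ 1) (k : ℕ) {i j : ℕ} (hij : i < j)
    {f : ℝ≥0∞ → ℝ} (hf : Measurable f) :
    IndepFun (fun C => f (crossing κ (regenerate hκ (i * k) C) k))
      (fun C => f (crossing κ (regenerate hκ (j * k) C) k)) (fieldLaw μ) := by
  obtain ⟨R⟩ : Nonempty Row := (rowLaw μ).nonempty_of_neZero
  have hle : i * k + k ≤ j * k := by
    rw [← Nat.succ_mul]
    exact Nat.mul_le_mul_right k hij
  have h1 : (fun C => f (crossing κ (regenerate hκ (i * k) C) k)) =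
      (fun C => f (crossing κ (regenerate hκ (i * k) C) k)) ∘ truncate R (j * k) := by
    ext1 C
    simp only [Function.comp_apply]
    congr 1
    exact crossing_congr (regenerate_congr hκ fun l hl => truncate_apply R (by omega) C)
  have hm : Measurable fun C => f (crossing κ C k) := hf.comp (measurable_crossing κ k)
  rw [h1]
  exact (indepFun_truncate_regenerate μ hκ R (j * k)).comp
    (hm.comp (measurePreserving_regenerate μ hκ (i * k)).measurable) hm

/-- The asymptotic speed of first-passage percolation in a field of independent rows. -/
theorem exists_tendsto_crossing_div {κ : ℝ} (hκ₀ : 0 < κ) (hκ : κ ≤ 1) :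
    ∃ c ∈ Set.Icc κ 1, ∀ᵐ C ∂fieldLaw μ,
      Tendsto (fun n : ℕ => crossing κ C n / (n : ℝ≥0∞)) atTop (𝓝 (ENNReal.ofReal c)) := by
  have hfin : ∀ (C : Field) (n : ℕ), crossing κ C n ≠ ⊤ := crossing_ne_top hκ
  have hle : ∀ (C : Field) (n : ℕ), (crossing κ C n).toReal ≤ n := fun C n => by
    simpa using ENNReal.toReal_mono (ENNReal.natCast_ne_top n) (crossing_le hκ C n)
  have hge : ∀ (C : Field) (n : ℕ), κ * n ≤ (crossing κ C n).toReal := fun C n => by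
    simpa [ENNReal.toReal_ofReal hκ₀.le] using
      ENNReal.toReal_mono (hfin C n) (le_crossing κ C n)
  obtain ⟨c, hc⟩ := exists_tendsto_div_of_subadditive (P := fieldLaw μ)
    (Y := fun n C => (crossing κ C n).toReal + 1) (Θ := fun m => regenerate hκ m)
    (fun n => (measurable_crossing κ n).ennreal_toReal.add_const 1)
    (fun n C => by positivity) (fun n C => by linarith [hle C n])
    (measurePreserving_regenerate μ hκ)
    (fun m n C => by
      have h := ENNReal.toReal_mono
        (by simp [hfin]) (crossing_add_one_subadditive hκ C m n)
      rw [ENNReal.toReal_add, ENNReal.toReal_add, ENNReal.toReal_add, ENNReal.toReal_add] at h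
      · simpa using h
      all_goals simp [hfin])
    (fun k i j hij => by
      have hf : Measurable fun x : ℝ≥0∞ => x.toReal + 1 :=
        ENNReal.measurable_toReal.add_const 1
      rcases hij.lt_or_gt with h | h
      · exact indepFun_blocks μ hκ k h hf
      · exact (indepFun_blocks μ hκ k h hf).symm)
  have hc' : ∀ᵐ C ∂fieldLaw μ,
      Tendsto (fun n : ℕ => (crossing κ C n).toReal / n) atTop (𝓝 c) := by
    filter_upwards [hc] with C hC
    -- Remove the additive `1` that was introduced for subadditivity.
    have h := hC.sub (tendsto_one_div_atTop_nhds_zero_nat (𝕜 := ℝ))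
    simp only [add_div, add_sub_cancel_right, sub_zero] at h
    exact h
  refine ⟨c, ?_, ?_⟩
  · obtain ⟨C, hC⟩ := hc'.exists
    refine ⟨ge_of_tendsto hC ?_, le_of_tendsto hC ?_⟩
    · filter_upwards [eventually_ge_atTop 1] with n hn
      rw [le_div_iff₀ (by exact_mod_cast hn)]
      exact hge C n
    · filter_upwards [eventually_ge_atTop 1] with n hn
      rw [div_le_one₀ (by exact_mod_cast hn)]
      exact hle C n
  · filter_upwards [hc'] with C hC
    refine (ENNReal.tendsto_ofReal hC).congr' ?_
    filter_upwards [eventually_ge_atTop 1] with n hn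
    rw [ENNReal.ofReal_div_of_pos (by exact_mod_cast hn), ENNReal.ofReal_toReal (hfin C n),
      ENNReal.ofReal_natCast]

end FieldLaw

/-! ### From the lower half-plane triangulation to the field of rows -/

namespace Env

variable (env : Env)

/-- The position of a vertex. -/
def pos : Vertex env → Pos
  | .grid i k => .grid i k
  | .inner i k v _ => .inner i k (Quotient.out v : Fin (env.filling i k).m)

theorem pos_injective : Function.Injective env.pos := by
  rintro (⟨i, k⟩ | ⟨i, k, v, hv⟩) (⟨j, l⟩ | ⟨j, l, v', hv'⟩) h
  · simpa [pos] using h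
  · simp [pos] at h
  · simp [pos] at h
  · simp only [pos, Pos.inner.injEq] at h
    obtain ⟨rfl, rfl, h⟩ := h
    have h2 : (Quotient.out v : Fin (env.filling i k).m) = Quotient.out v' := Fin.ext h
    have h3 : v = v' := by rw [← Quotient.out_eq v, ← Quotient.out_eq v', h2]
    subst h3
    rfl

open Classical in
theorem pos_glue (i : ℤ) (k : ℕ) (v : (env.filling i k).Vertex) :
    env.pos (env.glue i k v) =
      place (env.childStart i k) i k ((env.filling i k).slotPos v) := by
  unfold glue PolygonTriangulation.slotPos
  split_ifs with h
  · rcases Nat.find h with _ | _ | t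
    · simp only [corner, pos, place, childStart_succ]
    · rfl
    · rfl
  · rfl

/-- Every tree vertex of a positive generation has a parent. -/
def Covered : Prop := ∀ j k, ∃ i, env.IsChild j i k

variable {env}

theorem IsChild.unique {j i i' : ℤ} {k : ℕ} (h : env.IsChild j i k) (h' : env.IsChild j i' k) :
    i = i' := by
  by_contra hne
  rcases lt_or_gt_of_ne hne with hlt | hlt
  · have := env.childStart_mono k (show i + 1 ≤ i' by omega)
    exact absurd (h.2.trans_le (this.trans h'.1)) (lt_irrefl _)
  · have := env.childStart_mono k (show i' + 1 ≤ i by omega)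
    exact absurd (h'.2.trans_le (this.trans h.1)) (lt_irrefl _)

theorem isChild_add {i : ℤ} {k t : ℕ} (ht : t < env.offspring i k) :
    env.IsChild (env.childStart i k + t) i k := by
  refine ⟨by omega, ?_⟩
  rw [childStart_succ]
  omega

variable (env)

/-- The field of rows with the slots of `env` and the weights `w`. -/
def field (w : ℕ → RowLabel → ℝ) : Field := fun k => (fun i => env i k, w k)

/-- The weights `w` of the rows are those given by a function `W` on the edges. -/
structure Compatible (W : Edge env → ℝ) (w : ℕ → RowLabel → ℝ) : Prop where
  top : ∀ i, W (.top i) = w 0 (.inl i)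
  slot : ∀ i k d, ¬ (env.filling i k).IsBottom d →
    W (.slot i k ((env.filling i k).edge d)) =
      w k (.inr (i, (env.filling i k).edgeLabel ((env.filling i k).edge d)))
  bottom : ∀ i k t, t < env.offspring i k →
    W (.slot i k ((env.filling i k).edge ((env.filling i k).bottomDart t))) =
      w (k + 1) (.inl (env.childStart i k + t))

variable {env} {κ : ℝ} {W : Edge env → ℝ} {w : ℕ → RowLabel → ℝ}

/-- This is the stopping argument: as long as the line at depth `r` has not been met, every edge of
a path lies in one of the rows `0, …, r - 1`. Edges on the bottom of slot `(i, k)` are found in row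
`k + 1`. -/
theorem Compatible.arc_of_joins (hW : env.Compatible W w) {r : ℕ} {e : Edge env}
    {u v : Vertex env} (h : env.Joins e u v) (hu : (env.pos u).depth ≤ r) :
    (∃ j, env.pos u = .grid j r) ∨ ((env.pos v).depth ≤ r ∧
      ∃ k < r, Arc κ (env.field w k) k (env.pos u) (env.pos v) (cost κ (W e))) := by
  cases h with
  | top_right i =>
    rcases Nat.eq_zero_or_pos r with rfl | hr
    · exact Or.inl ⟨i, rfl⟩
    · refine Or.inr ⟨Nat.zero_le _, 0, hr, ?_⟩
      rw [hW.top]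
      exact .right i
  | top_left i =>
    rcases Nat.eq_zero_or_pos r with rfl | hr
    · exact Or.inl ⟨i + 1, rfl⟩
    · refine Or.inr ⟨Nat.zero_le _, 0, hr, ?_⟩
      rw [hW.top]
      exact .left i
  | slot i k d =>
    by_cases hd : (env.filling i k).IsBottom d
    · obtain ⟨t, ht, hd⟩ := hd.eq_or_eq
      have h1 := (env.filling i k).slotPos_origin_bottomDart ht.le
      have h2 := (env.filling i k).slotPos_origin_flip_bottomDart ht
      rcases hd with rfl | rfl
      · rw [pos_glue, h1] at hu
        simp only [pos_glue, h1, h2, place] at hu ⊢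
        simp only [Pos.depth] at hu ⊢
        rcases hu.eq_or_lt with rfl | hr
        · exact Or.inl ⟨_, rfl⟩
        · refine Or.inr ⟨hu, k + 1, hr, ?_⟩
          rw [hW.bottom i k t ht, Nat.cast_add, Nat.cast_one, ← add_assoc]
          exact .right _
      · rw [PolygonTriangulation.flip_flip, PolygonTriangulation.edge_flip]
        rw [pos_glue, h2] at hu
        simp only [pos_glue, h1, h2, place] at hu ⊢
        simp only [Pos.depth] at hu ⊢
        rcases hu.eq_or_lt with rfl | hr
        · exact Or.inl ⟨_, rfl⟩
        · refine Or.inr ⟨hu, k + 1, hr, ?_⟩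
          rw [hW.bottom i k t ht, Nat.cast_add, Nat.cast_one, ← add_assoc]
          exact .left _
    · simp only [pos_glue] at hu ⊢
      rcases lt_or_ge k r with hr | hr
      · refine Or.inr ⟨(depth_place_le _ _ _ _).trans hr, k, hr, ?_⟩
        rw [hW.slot i k d hd]
        exact Arc.slot (R := env.field w k) i d hd
      · left
        have hk := le_depth_place (env.childStart i k) i k
          ((env.filling i k).slotPos ((env.filling i k).origin d))
        obtain rfl : k = r := by omega
        generalize (env.filling i k).slotPos ((env.filling i k).origin d) = q at hu
        cases q with
        | top => exact ⟨i, rfl⟩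
        | bottom t => simp [place, Pos.depth] at hu
        | inner n => simp [place, Pos.depth] at hu

/-- Below depth `0`, a horizontal edge exists in the triangulation only as a bottom edge of the slot
of a parent; `Covered` provides this parent. -/
theorem Compatible.joins_of_arc (hW : env.Compatible W w) (hcov : env.Covered) {k : ℕ}
    {u : Vertex env} {q : Pos} {x : ℝ≥0∞} (h : Arc κ (env.field w k) k (env.pos u) q x) :
    ∃ v e, env.pos v = q ∧ env.Joins e u v ∧ x = cost κ (W e) := by
  have hgrid : ∀ j : ℤ, ∃ e, env.Joins e (.grid j k) (.grid (j + 1) k) ∧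
      env.Joins e (.grid (j + 1) k) (.grid j k) ∧ W e = w k (.inl j) := by
    intro j
    rcases k with _ | k
    · exact ⟨.top j, .top_right j, .top_left j, hW.top j⟩
    · obtain ⟨i, hi⟩ := hcov j k
      obtain ⟨t, ht⟩ := Int.le.dest hi.1
      have htc : t < env.offspring i k := by
        have := hi.2
        rw [childStart_succ] at this
        omega
      have h1 := (env.filling i k).slotPos_origin_bottomDart htc.le
      have h2 := (env.filling i k).slotPos_origin_flip_bottomDart htc
      have h3 : env.glue i k ((env.filling i k).origin ((env.filling i k).bottomDart t)) =
          .grid j (k + 1) := env.pos_injective (by rw [pos_glue, h1, place, ht]; rfl)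
      have h4 : env.glue i k ((env.filling i k).origin ((env.filling i k).flip
          ((env.filling i k).bottomDart t))) = .grid (j + 1) (k + 1) :=
        env.pos_injective (by
          rw [pos_glue, h2, place, Nat.cast_add, Nat.cast_one, ← add_assoc, ht]
          rfl)
      have h5 := Joins.slot (env := env) i k ((env.filling i k).bottomDart t)
      have h6 := Joins.slot (env := env) i k ((env.filling i k).flip
        ((env.filling i k).bottomDart t))
      rw [PolygonTriangulation.flip_flip, PolygonTriangulation.edge_flip] at h6
      rw [h3, h4] at h5 h6
      exact ⟨_, h5, h6, by rw [hW.bottom i k t htc, ht]⟩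
  generalize hp : env.pos u = p at h
  cases h with
  | right j =>
    obtain ⟨e, h1, -, h3⟩ := hgrid j
    obtain rfl : u = .grid j k := env.pos_injective hp
    exact ⟨_, e, rfl, h1, by rw [h3]; rfl⟩
  | left j =>
    obtain ⟨e, -, h2, h3⟩ := hgrid j
    obtain rfl : u = .grid (j + 1) k := env.pos_injective hp
    exact ⟨_, e, rfl, h2, by rw [h3]; rfl⟩
  | slot i d hd =>
    have h1 := Joins.slot (env := env) i k d
    have h2 : u = env.glue i k ((env.filling i k).origin d) :=
      env.pos_injective (hp.trans (env.pos_glue i k _).symm)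
    rw [← h2] at h1
    refine ⟨_, _, env.pos_glue i k _, h1, ?_⟩
    rw [hW.slot i k d hd]
    rfl

theorem Compatible.walk_of_path (hW : env.Compatible W w) {r : ℕ} {i : ℤ} {u v : Vertex env}
    {γ : List (Edge env)} (h : env.IsPath u γ v) (hv : v = .grid i r)
    (hu : (env.pos u).depth ≤ r) :
    ∃ j x, Walk κ (env.field w) r (env.pos u) (.grid j r) x ∧
      x ≤ (γ.map fun e => cost κ (W e)).sum := by
  induction h with
  | nil u =>
    subst hv
    exact ⟨i, 0, .nil _, zero_le⟩
  | @cons e u v' _ γ h _ ih =>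
    rcases hW.arc_of_joins (κ := κ) h hu with ⟨j, hj⟩ | ⟨hv', k, hk, harc⟩
    · exact ⟨j, 0, hj ▸ .nil _, zero_le⟩
    · obtain ⟨j, x, hx, hle⟩ := ih hv hv'
      refine ⟨j, _, .cons hk harc hx, ?_⟩
      rw [List.map_cons, List.sum_cons]
      gcongr

theorem Compatible.path_of_walk (hW : env.Compatible W w) (hcov : env.Covered) {n : ℕ}
    {u : Vertex env} {p q : Pos} {x : ℝ≥0∞} (h : Walk κ (env.field w) n p q x)
    (hp : env.pos u = p) :
    ∃ v γ, env.pos v = q ∧ env.IsPath u γ v ∧ (γ.map fun e => cost κ (W e)).sum = x := by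
  induction h generalizing u with
  | nil => exact ⟨u, [], hp, .nil u, rfl⟩
  | cons hk h _ ih =>
    rw [← hp] at h
    obtain ⟨v, e, hv, he, rfl⟩ := hW.joins_of_arc hcov h
    obtain ⟨v', γ, hv', hγ, rfl⟩ := ih hv
    exact ⟨v', e :: γ, hv', .cons he hγ, by simp⟩

theorem Compatible.dfppLine_eq_crossing (hW : env.Compatible W w) (hcov : env.Covered)
    (hκ : ∀ e, W e ∈ Set.Icc κ 1) (r : ℕ) :
    env.dfppLine W r = crossing κ (env.field w) r := by
  have hc : ∀ γ : List (Edge env), (γ.map fun e => ENNReal.ofReal (W e)).sum =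
      (γ.map fun e => cost κ (W e)).sum := fun γ => by simp only [cost_eq (hκ _)]
  refine le_antisymm (le_iInf fun i => le_iInf₂ fun x h => ?_)
    (le_iInf fun i => le_iInf₂ fun γ h => ?_)
  · obtain ⟨v, γ, hv, hγ, rfl⟩ := hW.path_of_walk hcov (u := .grid 0 0) h rfl
    obtain rfl : v = .grid i r := env.pos_injective hv
    exact (iInf_le _ i).trans ((iInf₂_le γ hγ).trans_eq (hc γ))
  · obtain ⟨j, x, hx, hle⟩ := hW.walk_of_path (κ := κ) h rfl (Nat.zero_le r)
    exact hx.crossing_le.trans (hle.trans_eq (hc γ).symm)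

end Env

/-! ### The labels of the edges -/

/-- The label of an edge of the bottom of a slot. -/
def bottomLabel (s : Slot) (t : ℕ) : ℕ := s.2.rep.edgeLabel (s.2.rep.edge (s.2.rep.bottomDart t))

open Classical in
/-- The labels of the edges that are not on the bottom of a slot are left invariant, and the other
numbers are sent to labels that are not in use. -/
def innerLabel (s : Slot) (n : ℕ) : ℕ :=
  if n < s.2.rep.m ∧ ∀ t < s.1, n ≠ bottomLabel s t then n else n + s.2.rep.m

theorem bottomLabel_lt (s : Slot) (t : ℕ) : bottomLabel s t < s.2.rep.m :=
  PolygonTriangulation.edgeLabel_lt _ _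

theorem bottomLabel_injOn {s : Slot} {t t' : ℕ} (ht : t < s.1) (ht' : t' < s.1)
    (h : bottomLabel s t = bottomLabel s t') : t = t' :=
  s.2.rep.edge_bottomDart_injOn ht ht' (s.2.rep.edgeLabel_injective h)

theorem innerLabel_injective (s : Slot) : Function.Injective (innerLabel s) := by
  intro n n' h
  unfold innerLabel at h
  split_ifs at h with h1 h2 h2 <;> omega

theorem innerLabel_ne_bottomLabel (s : Slot) (n : ℕ) {t : ℕ} (ht : t < s.1) :
    innerLabel s n ≠ bottomLabel s t := by
  unfold innerLabel
  split_ifs with h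
  · exact h.2 t ht
  · have := bottomLabel_lt s t
    omega

theorem innerLabel_edgeLabel (s : Slot) {d : Fin s.2.rep.m} (hd : ¬ s.2.rep.IsBottom d) :
    innerLabel s (s.2.rep.edgeLabel (s.2.rep.edge d)) = s.2.rep.edgeLabel (s.2.rep.edge d) :=
  if_pos ⟨PolygonTriangulation.edgeLabel_lt _ _, fun t ht h =>
    hd ⟨t, ht, s.2.rep.edgeLabel_injective h⟩⟩

open Classical in
/-- The label in the triangulation of an edge of the field of rows. -/
def Env.relabel (env : Env) : ℕ × RowLabel → Env.EdgeLabel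
  | (0, .inl j) => .inl j
  | (k + 1, .inl j) =>
    if h : ∃ i, env.IsChild j i k then
      .inr (h.choose, k,
        bottomLabel (env h.choose k) (j - env.childStart h.choose k).toNat)
    else .inl 0
  | (k, .inr (i, n)) => .inr (i, k, innerLabel (env i k) n)

namespace Env

variable {env : Env}

theorem relabel_of_isChild {j i : ℤ} {k : ℕ} (h : env.IsChild j i k) :
    env.relabel (k + 1, .inl j) =
      .inr (i, k, bottomLabel (env i k) (j - env.childStart i k).toNat) := by
  have hex : ∃ i, env.IsChild j i k := ⟨i, h⟩
  rw [relabel, dif_pos hex, hex.choose_spec.unique h]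

theorem relabel_inr (k : ℕ) (i : ℤ) (n : ℕ) :
    env.relabel (k, .inr (i, n)) = .inr (i, k, innerLabel (env i k) n) := by
  cases k <;> rfl

theorem IsChild.toNat_lt {j i : ℤ} {k : ℕ} (h : env.IsChild j i k) :
    (j - env.childStart i k).toNat < (env i k).1 := by
  have h1 := h.1
  have h2 := h.2
  rw [childStart_succ, offspring] at h2
  omega

/-- A horizontal edge below the top determines its parent slot and its rank there, and conversely.
The labels of other edges avoid the bottom labels thanks to `innerLabel`. -/
theorem Covered.relabel_injective (hcov : env.Covered) : Function.Injective env.relabel := by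
  have hinl : ∀ (k : ℕ) (j : ℤ) (k' : ℕ) (i : ℤ) (n : ℕ),
      env.relabel (k, .inl j) ≠ env.relabel (k', .inr (i, n)) := by
    intro k j k' i n h
    rw [relabel_inr] at h
    rcases k with _ | k
    · simp [relabel] at h
    · obtain ⟨i', hi'⟩ := hcov j k
      rw [relabel_of_isChild hi', Sum.inr.injEq, Prod.mk.injEq, Prod.mk.injEq] at h
      obtain ⟨rfl, rfl, h⟩ := h
      exact innerLabel_ne_bottomLabel _ _ hi'.toNat_lt h.symm
  rintro ⟨k, j | ⟨i, n⟩⟩ ⟨k', j' | ⟨i', n'⟩⟩ h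
  · rcases k with _ | k <;> rcases k' with _ | k'
    · simpa [relabel] using h
    · obtain ⟨i', hi'⟩ := hcov j' k'
      rw [relabel_of_isChild hi'] at h
      simp [relabel] at h
    · obtain ⟨i, hi⟩ := hcov j k
      rw [relabel_of_isChild hi] at h
      simp [relabel] at h
    · obtain ⟨i, hi⟩ := hcov j k
      obtain ⟨i', hi'⟩ := hcov j' k'
      rw [relabel_of_isChild hi, relabel_of_isChild hi', Sum.inr.injEq, Prod.mk.injEq,
        Prod.mk.injEq] at h
      obtain ⟨rfl, rfl, h⟩ := h
      have h2 := bottomLabel_injOn hi.toNat_lt hi'.toNat_lt h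
      have h3 := hi.1
      have h4 := hi'.1
      simp only [Prod.mk.injEq, Sum.inl.injEq, true_and]
      omega
  · exact absurd h (hinl _ _ _ _ _)
  · exact absurd h.symm (hinl _ _ _ _ _)
  · simp only [relabel_inr, Sum.inr.injEq, Prod.mk.injEq] at h
    obtain ⟨rfl, rfl, h⟩ := h
    rw [innerLabel_injective _ h]

theorem compatible_relabel (W : EdgeLabel → ℝ) :
    env.Compatible (fun e => W (env.label e)) fun k l => W (env.relabel (k, l)) where
  top _ := rfl
  slot i k d hd := by
    rw [relabel_inr]
    exact congrArg W (congrArg (fun n => Sum.inr (i, k, n))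
      (innerLabel_edgeLabel (env i k) hd).symm)
  bottom i k t ht := by
    rw [relabel_of_isChild (isChild_add ht), add_sub_cancel_left, Int.toNat_natCast]
    rfl

end Env

/-! ### The law of the field of rows of the lower half-plane triangulation -/

/-- The environment with given slots. -/
def envOf (s : ℤ × ℕ → Slot) : Env := fun i k => s (i, k)

theorem measurable_childStart (i : ℤ) (k : ℕ) :
    Measurable fun s : ℤ × ℕ → Slot => (envOf s).childStart i k :=
  (measurable_firstChild i).comp
    (measurable_pi_iff.mpr fun l => measurable_pi_apply ((l, k) : ℤ × ℕ))

theorem measurableSet_isChild (j i : ℤ) (k : ℕ) :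
    MeasurableSet {s : ℤ × ℕ → Slot | (envOf s).IsChild j i k} :=
  (measurableSet_le (measurable_childStart i k) measurable_const).inter
    (measurableSet_lt measurable_const (measurable_childStart (i + 1) k))

theorem measurable_relabel (l : ℕ × RowLabel) :
    Measurable fun s : ℤ × ℕ → Slot => (envOf s).relabel l := by
  obtain ⟨k, j | ⟨i, n⟩⟩ := l
  · rcases k with _ | k
    · exact measurable_const
    · refine measurable_to_countable' fun y => ?_
      -- The chosen parent is the unique one, so the event can be split over the countably many
      -- possible parents and positions of their first child.
      have h : (fun s : ℤ × ℕ → Slot => (envOf s).relabel (k + 1, .inl j)) ⁻¹' {y} =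
          (⋃ i : ℤ, {s | (envOf s).IsChild j i k} ∩ ⋃ a : ℤ,
            (fun s : ℤ × ℕ → Slot => (envOf s).childStart i k) ⁻¹' {a} ∩
            (fun s : ℤ × ℕ → Slot => s (i, k)) ⁻¹'
              {t | Sum.inr (i, k, bottomLabel t (j - a).toNat) = y}) ∪
          ((⋃ i : ℤ, {s | (envOf s).IsChild j i k})ᶜ ∩ {_s | Sum.inl 0 = y}) := by
        ext s
        by_cases hex : ∃ i, (envOf s).IsChild j i k
        · obtain ⟨i, hi⟩ := hex
          have huniq : ∀ i', (envOf s).IsChild j i' k ↔ i' = i :=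
            fun i' => ⟨fun h => h.unique hi, fun h => h ▸ hi⟩
          simp [Env.relabel_of_isChild hi, huniq, envOf]
        · have hno : ∀ i, ¬ (envOf s).IsChild j i k := not_exists.mp hex
          simp [Env.relabel, hno]
      rw [h]
      refine MeasurableSet.union (MeasurableSet.iUnion fun i =>
        (measurableSet_isChild j i k).inter (MeasurableSet.iUnion fun a => ?_))
        (MeasurableSet.inter (MeasurableSet.iUnion fun i => measurableSet_isChild j i k).compl
          (MeasurableSet.const _))
      exact (measurable_childStart i k (measurableSet_singleton a)).inter
        (measurable_pi_apply (i, k) trivial)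
  · simp only [Env.relabel_inr]
    exact (measurable_from_top (f := fun t : Slot =>
      (Sum.inr (i, k, innerLabel t n) : Env.EdgeLabel))).comp (measurable_pi_apply (i, k))

instance {α β : Type*} [MeasurableSpace α] [MeasurableSpace β] [MeasurableSingletonClass α]
    [MeasurableSingletonClass β] : MeasurableSingletonClass (α ⊕ β) :=
  ⟨by
    rintro (a | b)
    · rw [← Set.image_singleton]
      exact (measurableSet_singleton a).inl_image
    · rw [← Set.image_singleton]
      exact (measurableSet_singleton b).inr_image⟩

theorem measurable_weights :
    Measurable fun p : (ℤ × ℕ → Slot) × (Env.EdgeLabel → ℝ) =>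
      fun l => p.2 ((envOf p.1).relabel l) := by
  refine measurable_pi_iff.mpr fun l => ?_
  have h1 : Measurable fun p : Env.EdgeLabel × (Env.EdgeLabel → ℝ) => p.2 p.1 :=
    measurable_from_prod_countable_right fun x => measurable_pi_apply x
  exact h1.comp (((measurable_relabel l).comp measurable_fst).prodMk measurable_snd)

theorem measurableSet_slot (A : Set Slot) : MeasurableSet A := trivial

/-- The inequality needs no information on the partition function, which could a priori be zero or
infinite. -/
theorem tsum_boltzmannMass_le_one (p : ℕ) : ∑' t : Triang p, boltzmannMass t ≤ 1 := by
  simp only [boltzmannMass, div_eq_mul_inv, ENNReal.tsum_mul_right]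
  exact ENNReal.div_self_le_one

theorem slotLaw_childless_lt_one : slotLaw {s | s.1 = 0} < 1 := by
  have h1 : slotLaw {s | s.1 = 0} = theta 0 * ∑' t : Triang (0 + 2), boltzmannMass t := by
    rw [slotLaw, Measure.sum_apply _ (measurableSet_slot _), ENNReal.tsum_sigma', tsum_eq_single 0]
    · simp [Measure.dirac_apply' _ (measurableSet_slot _),
        ENNReal.tsum_mul_left]
    · intro c hc
      simp [Measure.dirac_apply' _ (measurableSet_slot _), hc]
  have h2 : theta 0 < 1 := by
    change ENNReal.ofReal (thetaCoeff 0) < 1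
    rw [thetaCoeff, ENNReal.ofReal_lt_one]
    norm_num
  rw [h1]
  exact (mul_le_of_le_one_right' (tsum_boltzmannMass_le_one _)).trans_lt h2

theorem measurePreserving_rows {α : Type*} [MeasurableSpace α] {β : Type*}
    (ν : Measure α) [IsProbabilityMeasure ν] :
    MeasurePreserving (fun (f : ℕ × β → α) k l => f (k, l))
      (Measure.infinitePi fun _ : ℕ × β => ν)
      (Measure.infinitePi fun _ : ℕ => Measure.infinitePi fun _ : β => ν) :=
  ⟨by fun_prop, Measure.infinitePi_map_curry fun _ _ => ν⟩

section Law

variable [IsProbabilityMeasure slotLaw]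

theorem ae_exists_offspring_pos {f : ℕ → ℤ × ℕ} (hf : Function.Injective f) :
    ∀ᵐ s ∂Measure.infinitePi fun _ : ℤ × ℕ => slotLaw, ∃ n, 0 < (s (f n)).1 := by
  have hmp : MeasurePreserving (fun (s : ℤ × ℕ → Slot) n => s (f n))
      (Measure.infinitePi fun _ => slotLaw) (Measure.infinitePi fun _ : ℕ => slotLaw) :=
    ⟨by fun_prop, Measure.map_infinitePi_infinitePi_of_inj (P := fun _ => slotLaw) hf⟩
  refine hmp.quasiMeasurePreserving.ae (p := fun s : ℕ → Slot => ∃ n, 0 < (s n).1) ?_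
  have hle : ∀ N : ℕ, (Measure.infinitePi fun _ : ℕ => slotLaw)
      {s | ¬ ∃ n, 0 < (s n).1} ≤ slotLaw {s | s.1 = 0} ^ N := by
    intro N
    calc (Measure.infinitePi fun _ : ℕ => slotLaw) {s | ¬ ∃ n, 0 < (s n).1}
        ≤ (Measure.infinitePi fun _ : ℕ => slotLaw)
          ((Finset.range N : Set ℕ).pi fun _ => {s | s.1 = 0}) := by
          refine measure_mono fun s hs n _ => ?_
          simpa using not_exists.mp hs n
      _ = slotLaw {s | s.1 = 0} ^ N := by
          rw [Measure.infinitePi_pi _ fun _ _ => measurableSet_slot _]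
          simp
  exact le_antisymm (ge_of_tendsto'
    (ENNReal.tendsto_pow_atTop_nhds_zero_of_lt_one slotLaw_childless_lt_one) hle) zero_le

/-- In each generation, individuals with children occur arbitrarily far on both sides, so
`childStart` is unbounded in both directions. The parent of `j` is the greatest `i` with `childStart
i k ≤ j`. -/
theorem ae_covered : ∀ᵐ s ∂Measure.infinitePi fun _ : ℤ × ℕ => slotLaw, (envOf s).Covered := by
  have h1 : ∀ᵐ s ∂Measure.infinitePi fun _ : ℤ × ℕ => slotLaw, ∀ (N k : ℕ),
      (∃ n : ℕ, 0 < (s ((N : ℤ) + n, k)).1) ∧ ∃ n : ℕ, 0 < (s (-(N : ℤ) - n, k)).1 := by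
    refine ae_all_iff.mpr fun N => ae_all_iff.mpr fun k => ?_
    refine (ae_exists_offspring_pos (f := fun n => ((N : ℤ) + n, k)) fun a b h => ?_).and
      (ae_exists_offspring_pos (f := fun n => (-(N : ℤ) - n, k)) fun a b h => ?_)
    · simpa using h
    · simpa using h
  filter_upwards [h1] with s hs j k
  have hsucc := fun i => (envOf s).childStart_succ i k
  have hmono := (envOf s).childStart_mono k
  have h0 : (envOf s).childStart 0 k = 0 := by simp [Env.childStart]
  have hup : ∀ M : ℕ, ∃ N : ℕ, (M : ℤ) ≤ (envOf s).childStart N k := by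
    intro M
    induction M with
    | zero => exact ⟨0, by simp [h0]⟩
    | succ M ih =>
      obtain ⟨N, hN⟩ := ih
      obtain ⟨n, hn⟩ := (hs N k).1
      refine ⟨N + n + 1, ?_⟩
      have h2 := hsucc ((N : ℤ) + n)
      have h3 : (envOf s).childStart N k ≤ (envOf s).childStart ((N : ℤ) + n) k :=
        hmono (by omega)
      have h4 : 0 < (envOf s).offspring ((N : ℤ) + n) k := hn
      push_cast
      omega
  have hdown : ∀ M : ℕ, ∃ N : ℕ, (envOf s).childStart (-(N : ℤ)) k ≤ -M := by
    intro M
    induction M with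
    | zero => exact ⟨0, by simp [h0]⟩
    | succ M ih =>
      obtain ⟨N, hN⟩ := ih
      obtain ⟨n, hn⟩ := (hs (N + 1) k).2
      refine ⟨N + 1 + n, ?_⟩
      have h2 := hsucc (-((N + 1 : ℕ) : ℤ) - n)
      have h3 : (envOf s).childStart (-((N + 1 : ℕ) : ℤ) - n + 1) k ≤
        (envOf s).childStart (-(N : ℤ)) k := hmono (by push_cast; omega)
      have h4 : 0 < (envOf s).offspring (-((N + 1 : ℕ) : ℤ) - n) k := hn
      rw [show -((N + 1 + n : ℕ) : ℤ) = -((N + 1 : ℕ) : ℤ) - n by push_cast; ring]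
      push_cast at *
      omega
  obtain ⟨a, ha⟩ := hdown j.natAbs
  obtain ⟨b, hb⟩ := hup (j.natAbs + 1)
  obtain ⟨i, hi, hmax⟩ := Int.exists_greatest_of_bdd
    (P := fun i => (envOf s).childStart i k ≤ j)
    ⟨b, fun i hi => by
      by_contra hlt
      have := hmono (show (b : ℤ) ≤ i by omega)
      simp only at this
      push_cast at hb
      have := le_abs_self j
      omega⟩ ⟨-a, by omega⟩
  exact ⟨i, hi, not_le.mp fun h => by have := hmax (i + 1) h; omega⟩

variable (μ : Measure ℝ) [IsProbabilityMeasure μ]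

/-- For fixed slots that are covered, an i.i.d. family is read along an injection and remains
i.i.d.; the law obtained does not depend on the slots, so independence from them persists. -/
theorem measurePreserving_weights :
    MeasurePreserving (fun p : (ℤ × ℕ → Slot) × (Env.EdgeLabel → ℝ) =>
        (p.1, fun l => p.2 ((envOf p.1).relabel l)))
      ((Measure.infinitePi fun _ : ℤ × ℕ => slotLaw).prod
        (Measure.infinitePi fun _ : Env.EdgeLabel => μ))
      ((Measure.infinitePi fun _ : ℤ × ℕ => slotLaw).prod
        (Measure.infinitePi fun _ : ℕ × RowLabel => μ)) := by
  refine MeasurePreserving.skew_product (MeasurePreserving.id _)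
    (g := fun (s : ℤ × ℕ → Slot) (W : Env.EdgeLabel → ℝ) l => W ((envOf s).relabel l))
    measurable_weights ?_
  filter_upwards [ae_covered] with s hs
  exact Measure.map_infinitePi_infinitePi_of_inj (P := fun _ : Env.EdgeLabel => μ)
    hs.relabel_injective

theorem measurePreserving_field :
    MeasurePreserving (fun p : (ℤ × ℕ → Slot) × (ℕ × RowLabel → ℝ) =>
        (envOf p.1).field fun k l => p.2 (k, l))
      ((Measure.infinitePi fun _ : ℤ × ℕ => slotLaw).prod
        (Measure.infinitePi fun _ : ℕ × RowLabel => μ))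
      (fieldLaw μ) := by
  have h1 : MeasurePreserving (fun (s : ℤ × ℕ → Slot) (x : ℕ × ℤ) => s x.swap)
      (Measure.infinitePi fun _ => slotLaw) (Measure.infinitePi fun _ => slotLaw) :=
    ⟨by fun_prop, Measure.map_infinitePi_infinitePi_of_inj (P := fun _ : ℤ × ℕ => slotLaw)
      Prod.swap_injective⟩
  exact (measurePreserving_zip _ _).comp
    (((measurePreserving_rows slotLaw).comp h1).prod (measurePreserving_rows μ))

end Law

/-! ### Transfer to a given weighted triangulation -/

theorem IsWeightedLHPT.isProbabilityMeasure_slotLaw {Ω : Type*} [MeasurableSpace Ω]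
    {P : Measure Ω} [IsProbabilityMeasure P] {slot : ℤ × ℕ → Ω → Slot}
    {W : Env.EdgeLabel → Ω → ℝ} {μ : Measure ℝ} (h : IsWeightedLHPT P slot W μ) :
    IsProbabilityMeasure slotLaw := by
  rw [← h.map_slot (0, 0)]
  exact Measure.isProbabilityMeasure_map (h.measurable_slot (0, 0)).aemeasurable

theorem IsWeightedLHPT.measurePreserving {Ω : Type*} [MeasurableSpace Ω]
    {P : Measure Ω} [IsProbabilityMeasure P] {slot : ℤ × ℕ → Ω → Slot}
    {W : Env.EdgeLabel → Ω → ℝ} {μ : Measure ℝ} [IsProbabilityMeasure μ]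
    [IsProbabilityMeasure slotLaw] (h : IsWeightedLHPT P slot W μ) :
    MeasurePreserving (fun ω => ((fun x => slot x ω : ℤ × ℕ → Slot), fun l => W l ω)) P
      ((Measure.infinitePi fun _ : ℤ × ℕ => slotLaw).prod
        (Measure.infinitePi fun _ : Env.EdgeLabel => μ)) := by
  have h1 : Measurable fun ω => (fun x => slot x ω : ℤ × ℕ → Slot) :=
    measurable_pi_iff.mpr h.measurable_slot
  have h2 : Measurable fun ω => (fun l => W l ω : Env.EdgeLabel → ℝ) :=
    measurable_pi_iff.mpr h.measurable_weight
  refine ⟨h1.prodMk h2, ?_⟩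
  rw [h.indep.map_prod_eq_prod_map_map h1.aemeasurable h2.aemeasurable,
    h.indep_slot.map_fun_eq_infinitePi_map h.measurable_slot,
    h.indep_weight.map_fun_eq_infinitePi_map h.measurable_weight]
  simp only [h.map_slot, h.map_weight]

/-- Almost surely, the first-passage percolation distances from the root vertex to the horizontal
lines are the crossing costs of a field of independent rows. -/
theorem IsWeightedLHPT.ae_rootToLine_eq {Ω : Type*} [MeasurableSpace Ω]
    {P : Measure Ω} [IsProbabilityMeasure P] {slot : ℤ × ℕ → Ω → Slot}
    {W : Env.EdgeLabel → Ω → ℝ} {μ : Measure ℝ} [IsProbabilityMeasure μ]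
    [IsProbabilityMeasure slotLaw] (h : IsWeightedLHPT P slot W μ) {κ : ℝ}
    (hμ : μ (Set.Icc κ 1)ᶜ = 0) :
    ∀ᵐ ω ∂P, ∀ r, rootToLine slot W ω r =
      crossing κ ((envAt slot ω).field fun k l => W ((envAt slot ω).relabel (k, l)) ω) r := by
  have hcov : ∀ᵐ ω ∂P, (envAt slot ω).Covered :=
    (measurePreserving_fst.comp h.measurePreserving).quasiMeasurePreserving.ae ae_covered
  have hw : ∀ᵐ ω ∂P, ∀ l, W l ω ∈ Set.Icc κ 1 := by
    refine ae_all_iff.mpr fun l => ?_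
    have h1 : ∀ᵐ x ∂P.map (W l), x ∈ Set.Icc κ 1 := by
      rw [h.map_weight]
      exact hμ
    exact ae_of_ae_map (h.measurable_weight l).aemeasurable h1
  filter_upwards [hcov, hw] with ω hω hωw r
  exact (Env.compatible_relabel fun l => W l ω).dfppLine_eq_crossing hω (fun e => hωw _) r

end LHPT

end

/-! ### The limit for the lower half-plane triangulation -/

theorem mainTheorem8 (κ : ℝ) (hκ₀ : 0 < κ) (hκ₁ : κ ≤ 1)
    (μ : Measure ℝ) [IsProbabilityMeasure μ] (hμ : μ (Set.Icc κ 1)ᶜ = 0) :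
    ∃ c₀ ∈ Set.Icc κ 1,
      ∀ {Ω : Type*} [MeasurableSpace Ω] (P : Measure Ω) [IsProbabilityMeasure P]
        (slot : ℤ × ℕ → Ω → LHPT.Slot) (W : LHPT.Env.EdgeLabel → Ω → ℝ),
        LHPT.IsWeightedLHPT P slot W μ →
        ∀ᵐ ω ∂P, Tendsto (fun r : ℕ => LHPT.rootToLine slot W ω r / (r : ℝ≥0∞)) atTop
          (𝓝 (ENNReal.ofReal c₀)) := by
  -- Having total mass one amounts to an enumeration result on triangulations, which is not needed:
  -- otherwise no slot could have law `slotLaw`, and any constant works vacuously.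
  by_cases hprob : IsProbabilityMeasure LHPT.slotLaw
  · obtain ⟨c₀, hc₀, hlim⟩ := LHPT.exists_tendsto_crossing_div μ hκ₀ hκ₁
    refine ⟨c₀, hc₀, fun P _ slot W h => ?_⟩
    have hmp := (LHPT.measurePreserving_field μ).comp
      ((LHPT.measurePreserving_weights μ).comp h.measurePreserving)
    filter_upwards [hmp.quasiMeasurePreserving.ae hlim, h.ae_rootToLine_eq hμ] with ω hω heq
    simp only [heq]
    exact hω
  · exact ⟨1, ⟨hκ₁, le_rfl⟩, fun P _ slot W h => absurd h.isProbabilityMeasure_slotLaw hprob⟩
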